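/- Consider partitions $\lambda=(\lambda_1\ge\lambda_2\ge\cdots)$ into positive integers in which every part carries one of two colours, red or green; write $c(\lambda_i)$ for the colour of $\lambda_i$. (Two partitions are the same if they have the same multiset of coloured parts.) For $n,k,\ell,m\ge 0$ let $A_2(n;k,\ell,m)$ be the number of such two-coloured partitions of $n$ having $k$ odd red parts, $\ell$ even red parts and $m$ odd green parts, such that no part is a green $1$ and, for all consecutive parts, $$\lambda_i-\lambda_{i+1}\ \ge\ \begin{cases}1,&\text{if }\lambda_i\text{ is odd and }c(\lambda_i)\ne c(\lambda_{i+1}),\\ 2,&\text{if }\lambda_i\text{ is even and }c(\lambda_i)\neq c(\lambda_{i+1}),\\ 3,&\text{if }\lambda_i\text{ is odd and }c(\lambda_i)=c(\lambda_{i+1}).\end{cases}$$ Let $B_2(n;k,\ell,m)$ be the number of two-coloured partitions of $n$ whose odd parts are distinct and in which only parts congruent to $2$ modulo $4$ may be green, having $k$ parts congruent to $1$ modulo $4$, $\ell$ green parts, and $m$ parts congruent to $3$ modulo $4$. Write $(x;t)_\infty=\prod_{j\ge0}(1-xt^j)$. Then: 1. As formal power series in $q,a,c,d$ (with convergent infinite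 products and an invertible denominator), $$\sum_{n,k,\ell,m\ge0}A_2(n;k,\ell,m)\,q^na^kc^\ell d^m=\frac{(-aq;q^4)_\infty(-dq^3;q^4)_\infty}{(q^2;q^2)_\infty(cq^2;q^4)_\infty}.$$ 2. $A_2(n;k,\ell,m)=B_2(n;k,\ell,m)$ for all $n,k,\ell,m\ge0$. 3. Setting $a=c=d=1$ recovers Primc's identity. Here consider partitions into parts $k_x$ of size $k\ge1$ and colour $x\in\{a,b,c,d\}$, listed in non-increasing order for $1_a<1_b<1_c<1_d<2_a<2_b<\cdots$, such that a part of colour $x$ directly followed by a part of colour $y$ exceeds it in size by at least the entry $(x,y)$ of $$D=\begin{pmatrix}2&1&2&2\\1&0&1&1\\0&1&0&2\\0&1&0&2\end{pmatrix}$$ (rows and columns indexed by $a,b,c,d$). Let $P(n)$ be the number of these for which the dilated parts $k_a\mapsto 2k-1$, $k_b\mapsto 2k$, $k_c\mapsto 2k$, $k_d\mapsto 2k+1$ have sum $n$. Then $\sum_{k,\ell,m\ge0}A_2(n;k,\ell,m)=P(n)$ for every $n\ge0$, and as formal power series in $q$, $$\frac{(-q;q^4)_\infty(-q^3;q^4)_\infty}{(q^2;q^2)_\infty(q^2;q^4)_\infty}=\frac1{(q;q)_\infty},\qquad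 \sum_{n\ge0}P(n)\,q^n=\frac{1}{(q;q)_\infty}.$$ -/

import Mathlib

open scoped MvPowerSeries.WithPiTopology PowerSeries.WithPiTopology

namespace PrimcRefined

/-! ### Coloured partitions -/

/-- A partition into parts coloured by `C`: a finite multiset of coloured positive integers
(a coloured integer is a pair `(size, colour)`). -/
def IsColouredPartition {C : Type} (p : Multiset (ℕ × C)) : Prop :=
  ∀ x ∈ p, 0 < x.1

/-- The integer that a coloured partition partitions: the sum of its parts. -/
def size {C : Type} (p : Multiset (ℕ × C)) : ℕ :=
  (p.map Prod.fst).sum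

/-- There are finitely many partitions of `n` into parts with finitely many colours, so that the
cardinalities below are honest. -/
theorem finite_colouredPartitions {C : Type} [Finite C] (n : ℕ) :
    {p : Multiset (ℕ × C) | IsColouredPartition p ∧ size p = n}.Finite := by
  classical
  have := Fintype.ofFinite C
  refine (Set.finite_Iic
    (n • (Finset.range (n + 1) ×ˢ (Finset.univ : Finset C)).val)).subset ?_
  rintro p ⟨hp, hs⟩
  rw [Set.mem_Iic, Multiset.le_iff_count]
  intro x
  by_cases hx : x ∈ p
  · have h1 : x.1 ≤ n := by
      rw [← hs]
      exact Multiset.single_le_sum (fun _ _ => Nat.zero_le _) _ (Multiset.mem_map_of_mem _ hx)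
    have h2 : p.card ≤ n := by
      have := Multiset.card_nsmul_le_sum (s := p.map Prod.fst) (a := 1) (by
        intro y hy
        obtain ⟨z, hz, rfl⟩ := Multiset.mem_map.1 hy
        exact hp z hz)
      rw [← hs]
      simpa [size] using this
    have h3 : x ∈ (Finset.range (n + 1) ×ˢ (Finset.univ : Finset C)).val := by
      rw [Finset.mem_val, Finset.mem_product]
      exact ⟨Finset.mem_range.2 (by omega), Finset.mem_univ _⟩
    rw [Multiset.count_nsmul,
      Multiset.count_eq_one_of_mem (Finset.nodup _) h3, mul_one]
    exact (Multiset.count_le_card _ _).trans h2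
  · rw [Multiset.count_eq_zero_of_notMem hx]
    exact Nat.zero_le _

/-! ### The two-coloured partitions with difference conditions -/

/-- The two colours. -/
inductive Colour
  | red
  | green
  deriving DecidableEq

/-- The minimal difference required between a part `x` and the next part `y`
(`0` when no condition is imposed). -/
def minGap (x y : ℕ × Colour) : ℕ :=
  if x.2 ≠ y.2 then (if Odd x.1 then 1 else 2)
  else (if Odd x.1 then 3 else 0)

/-- The parts, listed in non-increasing order `λ₁ ≥ λ₂ ≥ ⋯`, satisfy
`λᵢ - λᵢ₊₁ ≥ minGap λᵢ λᵢ₊₁`.  Two parts of equal size and different colours can never be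
neighbours in such a list, so the list is unique and no convention is needed on how to order
equal parts of different colours. -/
def GapCondition (p : Multiset (ℕ × Colour)) : Prop :=
  ∃ l : List (ℕ × Colour), (l : Multiset (ℕ × Colour)) = p ∧
    l.IsChain (fun x y => y.1 ≤ x.1 ∧ y.1 + minGap x y ≤ x.1)

/-- The number of two-coloured partitions of `n` with no green `1` that satisfy the gap
condition and have `k` odd red parts, `l` even red parts and `m` odd green parts. -/
noncomputable def A₂ (n k l m : ℕ) : ℕ :=
  Set.ncard {p : Multiset (ℕ × Colour) |
    IsColouredPartition p ∧ size p = n ∧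
    (1, Colour.green) ∉ p ∧ GapCondition p ∧
    p.countP (fun x => Odd x.1 ∧ x.2 = Colour.red) = k ∧
    p.countP (fun x => Even x.1 ∧ x.2 = Colour.red) = l ∧
    p.countP (fun x => Odd x.1 ∧ x.2 = Colour.green) = m}

/-- The number of two-coloured partitions of `n` whose odd parts are distinct and in which only
parts congruent to `2` modulo `4` may be green, with `k` parts congruent to `1` modulo `4`,
`l` green parts and `m` parts congruent to `3` modulo `4`. -/
noncomputable def B₂ (n k l m : ℕ) : ℕ :=
  Set.ncard {p : Multiset (ℕ × Colour) |
    IsColouredPartition p ∧ size p = n ∧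
    ((p.map Prod.fst).filter (fun s => Odd s)).Nodup ∧
    (∀ x ∈ p, x.2 = Colour.green → x.1 % 4 = 2) ∧
    p.countP (fun x => x.1 % 4 = 1) = k ∧
    p.countP (fun x => x.2 = Colour.green) = l ∧
    p.countP (fun x => x.1 % 4 = 3) = m}

/-! ### Primc's four-coloured partitions

The colours `a, b, c, d` are `0, 1, 2, 3 : Fin 4`. -/

/-- The matrix of difference conditions: the entry `(x, y)` is the minimal difference between
a part of colour `x` and the next part, of colour `y`. -/
def primcMatrix : Matrix (Fin 4) (Fin 4) ℕ :=
  !![2, 1, 2, 2;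
     1, 0, 1, 1;
     0, 1, 0, 2;
     0, 1, 0, 2]

/-- The parts, listed in non-increasing order for `1_a < 1_b < 1_c < 1_d < 2_a < 2_b < ⋯`,
satisfy the difference conditions of `primcMatrix`. -/
def PrimcCondition (p : Multiset (ℕ × Fin 4)) : Prop :=
  ∃ l : List (ℕ × Fin 4), (l : Multiset (ℕ × Fin 4)) = p ∧
    l.IsChain (fun x y =>
      (y.1 < x.1 ∨ (y.1 = x.1 ∧ y.2 ≤ x.2)) ∧ y.1 + primcMatrix x.2 y.2 ≤ x.1)

/-- The dilation `k_a ↦ 2k - 1`, `k_b ↦ 2k`, `k_c ↦ 2k`, `k_d ↦ 2k + 1`. -/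
def primcDilation (x : ℕ × Fin 4) : ℕ :=
  ![2 * x.1 - 1, 2 * x.1, 2 * x.1, 2 * x.1 + 1] x.2

/-- The number of four-coloured partitions satisfying Primc's difference conditions whose
dilated parts sum to `n`. -/
noncomputable def primcCount (n : ℕ) : ℕ :=
  Set.ncard {p : Multiset (ℕ × Fin 4) |
    IsColouredPartition p ∧ PrimcCondition p ∧ (p.map primcDilation).sum = n}

/-! ### Generating functions -/

/-- The factors of `(x; t)_∞ = ∏_{j ≥ 0} (1 - x t^j)` form a convergent infinite product. -/
def QPochhammerConverges {R : Type} [CommRing R] [TopologicalSpace R] (x t : R) : Prop :=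
  Multipliable (fun j : ℕ => 1 - x * t ^ j)

/-- `(x; t)_∞ = ∏_{j ≥ 0} (1 - x t^j)`. -/
noncomputable def qPochhammer {R : Type} [CommRing R] [TopologicalSpace R] (x t : R) : R :=
  ∏' j : ℕ, (1 - x * t ^ j)

/-- The four formal variables. -/
inductive Var
  | q
  | a
  | c
  | d
  deriving DecidableEq

/-- The formal variables as power series in `ℤ⟦q, a, c, d⟧`. -/
noncomputable def var (v : Var) : MvPowerSeries Var ℤ := MvPowerSeries.X v

/-- The formal power series `∑ F(n; k, l, m) q^n a^k c^l d^m`. -/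
def genFun (F : ℕ → ℕ → ℕ → ℕ → ℕ) : MvPowerSeries Var ℤ :=
  fun e => (F (e Var.q) (e Var.a) (e Var.c) (e Var.d) : ℤ)

end PrimcRefined

open PrimcRefined

/-!
Dilating the parts of Primc's partitions and colouring `a, c` red and `b, d` green turns them into
the partitions counted by `A₂`. Removing the largest part gives, with `Q = q²`, a linear recurrence
for the generating functions `γ k` of Primc's partitions that may follow the part `(k + 1)_a`. As
`k` grows, `γ k` tends to the generating function of all of Primc's partitions.

The series `Γ = ∑ γ k X^k` then solves a system of first-order `Q`-difference equations, whose
solution is Euler's series `E(X) = ∑ Q^(m(m-1)/2) X^m / ((1-Q)⋯(1-Q^m))` times the basic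
hypergeometric series `φ = ₂φ₁(-aq, -dq³; cq²; q⁴, X²)`. Since `E(X) = (1 + X) E(QX)`, the
coefficient of `X^n` is a convolution of `E(QX)` with `(1 + X) φ`, whose coefficients are those of
`φ`, each repeated twice. In the limit `n → ∞` it becomes `E(Q) = (-Q; Q)_∞` times the limit
`(-aq; q⁴)_∞ (-dq³; q⁴)_∞ / ((cq²; q⁴)_∞ (q⁴; q⁴)_∞)` of the coefficients of `φ`, and the
factor `(-Q; Q)_∞` cancels because `(q⁴; q⁴)_∞ = (Q; Q)_∞ (-Q; Q)_∞`. The resulting product is also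
the Euler product that enumerates the partitions counted by `B₂`.
-/

namespace PrimcRefined

/-! ### Limits in linear topologies -/

section LinearTopology

open Filter Topology Finset

variable {A : Type*} [CommRing A] [TopologicalSpace A] [IsTopologicalRing A] [IsLinearTopology A A]

theorem tendsto_of_isUnit_of_tendsto_mul {ι : Type*} {l : Filter ι} {u x : ι → A} {u' v : A}
    (hu : ∀ i, IsUnit (u i)) (hu' : Tendsto u l (𝓝 u'))
    (hux : Tendsto (fun i => u i * x i) l (𝓝 (u' * v))) : Tendsto x l (𝓝 v) := by
  have hzero : Tendsto (fun i => u i * (x i - v)) l (𝓝 0) := by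
    simpa only [mul_sub, sub_self] using hux.sub (hu'.mul_const v)
  rw [← tendsto_sub_nhds_zero_iff]
  refine (IsLinearTopology.tendsto_mul_zero_of_right (fun i => Ring.inverse (u i)) _ hzero).congr
    fun i => ?_
  exact Ring.inverse_mul_cancel_left _ _ (hu i)

theorem tendsto_sum_antidiagonal_mul {f k : ℕ → A} {s κ : A} (hf : HasSum f s)
    (hk : Tendsto k atTop (𝓝 κ)) :
    Tendsto (fun N => ∑ x ∈ antidiagonal N, f x.1 * k x.2) atTop (𝓝 (s * κ)) := by
  have hmain : Tendsto (fun N => (∑ m ∈ range (N + 1), f m) * κ) atTop (𝓝 (s * κ)) :=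
    (hf.tendsto_sum_nat.comp (tendsto_add_atTop_nat 1)).mul_const κ
  have herror : Tendsto (fun N => ∑ x ∈ antidiagonal N, f x.1 * (k x.2 - κ)) atTop (𝓝 0) := by
    refine IsLinearTopology.hasBasis_ideal.tendsto_right_iff.2 fun I hI => ?_
    obtain ⟨M, hM⟩ := eventually_atTop.1 (hf.summable.tendsto_atTop_zero.eventually_mem hI)
    obtain ⟨J, hJ⟩ := eventually_atTop.1
      ((tendsto_sub_nhds_zero_iff.2 hk).eventually_mem hI)
    filter_upwards [eventually_ge_atTop (M + J)] with N hN
    refine I.sum_mem fun x hx => ?_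
    rw [HasAntidiagonal.mem_antidiagonal] at hx
    rcases le_or_gt M x.1 with h | h
    · exact I.mul_mem_right _ (hM _ h)
    · exact I.mul_mem_left _ (hJ _ (by omega))
  rw [← add_zero (s * κ)]
  refine (hmain.add herror).congr fun N => ?_
  rw [← Nat.sum_antidiagonal_eq_sum_range_succ (fun m _ => f m), sum_mul, ← sum_add_distrib]
  exact sum_congr rfl fun x _ => by ring

end LinearTopology

/-! ### Infinite products and Euler's series -/

section QPochhammer

open Filter Topology Finset

variable {A : Type} [CommRing A] [TopologicalSpace A] {x t : A}

theorem QPochhammerConverges.tendsto_prod_range (h : QPochhammerConverges x t) :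
    Tendsto (fun n => ∏ j ∈ range n, (1 - x * t ^ j)) atTop (𝓝 (qPochhammer x t)) :=
  h.tendsto_prod_tprod_nat

theorem qPochhammer_mul_qPochhammer_neg [T2Space A] [ContinuousMul A]
    (h : QPochhammerConverges x t) (h' : QPochhammerConverges (-x) t) :
    qPochhammer x t * qPochhammer (-x) t = qPochhammer (x ^ 2) (t ^ 2) := by
  rw [qPochhammer, qPochhammer, ← Multipliable.tprod_mul h h']
  exact tprod_congr fun j => by ring

theorem qPochhammer_mul_qPochhammer_mul [T2Space A] [ContinuousMul A]
    (h : QPochhammerConverges x (t ^ 2)) (h' : QPochhammerConverges (x * t) (t ^ 2)) :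
    qPochhammer x (t ^ 2) * qPochhammer (x * t) (t ^ 2) = qPochhammer x t := by
  have heven : ∀ j, 1 - x * (t ^ 2) ^ j = 1 - x * t ^ (2 * j) := fun j => by ring
  have hodd : ∀ j, 1 - x * t * (t ^ 2) ^ j = 1 - x * t ^ (2 * j + 1) := fun j => by ring
  simp only [QPochhammerConverges, heven, hodd] at h h'
  simp only [qPochhammer, heven, hodd]
  exact tprod_even_mul_odd (f := fun j => 1 - x * t ^ j) h h'

end QPochhammer

section PowerSeries

open Filter Topology

variable {σ R : Type} [CommRing R]

theorem isUnit_one_sub {f : MvPowerSeries σ R} (hf : f.constantCoeff = 0) : IsUnit (1 - f) := by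
  simp [MvPowerSeries.isUnit_iff_constantCoeff, hf]

theorem tendsto_order_mul_pow (f : ℕ → MvPowerSeries σ R) {t : MvPowerSeries σ R}
    (ht : t.constantCoeff = 0) : Tendsto (fun j => (f j * t ^ j).order) atTop (𝓝 ⊤) := by
  rw [ENat.tendsto_nhds_top_iff_natCast_lt]
  intro n
  filter_upwards [eventually_gt_atTop n] with j hj
  calc (n : ℕ∞) < j := mod_cast hj
    _ ≤ (t ^ j).order := MvPowerSeries.le_order_pow_of_constantCoeff_eq_zero j ht
    _ ≤ (f j * t ^ j).order := le_add_self.trans MvPowerSeries.le_order_mul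

variable [TopologicalSpace R]

theorem summable_mul_pow (f : ℕ → MvPowerSeries σ R) {t : MvPowerSeries σ R}
    (ht : t.constantCoeff = 0) : Summable fun j => f j * t ^ j :=
  MvPowerSeries.WithPiTopology.summable_of_tendsto_order_atTop_nhds_top
    (tendsto_order_mul_pow f ht)

theorem qPochhammerConverges (x : MvPowerSeries σ R) {t : MvPowerSeries σ R}
    (ht : t.constantCoeff = 0) : QPochhammerConverges x t :=
  (MvPowerSeries.WithPiTopology.multipliable_one_add_of_tendsto_order_atTop_nhds_top
    (tendsto_order_mul_pow (fun _ => -x) ht)).congr fun j => by ring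

theorem constantCoeff_qPochhammer [T2Space R] (x : MvPowerSeries σ R) {t : MvPowerSeries σ R}
    (ht : t.constantCoeff = 0) : (qPochhammer x t).constantCoeff = 1 - x.constantCoeff := by
  rw [qPochhammer, (qPochhammerConverges x ht).map_tprod (MvPowerSeries.constantCoeff (R := R))
    (MvPowerSeries.WithPiTopology.continuous_constantCoeff R), tprod_eq_mulSingle 0]
  · simp
  · intro j hj
    simp [ht, hj]

theorem isUnit_qPochhammer [T2Space R] {x t : MvPowerSeries σ R} (hx : x.constantCoeff = 0)
    (ht : t.constantCoeff = 0) : IsUnit (qPochhammer x t) := by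
  simp [MvPowerSeries.isUnit_iff_constantCoeff, constantCoeff_qPochhammer x ht, hx]

end PowerSeries

section Euler

open Filter Topology Finset

variable {A : Type*} [CommRing A]

/-- The coefficient `Q^(m(m-1)/2) / ((1-Q)(1-Q²)⋯(1-Q^m))` of `x^m` in Euler's expansion of
`(-x; Q)_∞`. -/
noncomputable def eulerCoeff (Q : A) (m : ℕ) : A :=
  ∏ i ∈ range m, Q ^ i * Ring.inverse (1 - Q ^ (i + 1))

theorem eulerCoeff_zero (Q : A) : eulerCoeff Q 0 = 1 := prod_range_zero _

theorem eulerCoeff_succ {Q : A} (hQ : ∀ i, IsUnit (1 - Q ^ (i + 1))) (m : ℕ) :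
    eulerCoeff Q (m + 1) = Q ^ m * eulerCoeff Q m + Q ^ (m + 1) * eulerCoeff Q (m + 1) := by
  rw [eulerCoeff, prod_range_succ, ← eulerCoeff]
  linear_combination (eulerCoeff Q m * Q ^ m) * Ring.mul_inverse_cancel _ (hQ m)

variable {σ R : Type} [CommRing R] [TopologicalSpace R] [IsTopologicalRing R] [T2Space R]

theorem tsum_eulerCoeff_mul_pow_eq_one_add_mul {Q x : MvPowerSeries σ R}
    (hQ : Q.constantCoeff = 0) (hx : x.constantCoeff = 0) :
    ∑' m, eulerCoeff Q m * x ^ m = (1 + x) * ∑' m, eulerCoeff Q m * (x * Q) ^ m := by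
  have hxQ : (x * Q).constantCoeff = 0 := by simp [hQ]
  have hunit : ∀ i, IsUnit (1 - Q ^ (i + 1)) := fun i => isUnit_one_sub (by simp [hQ])
  have hs := summable_mul_pow (eulerCoeff Q) hxQ
  have hterm : ∀ m, eulerCoeff Q (m + 1) * x ^ (m + 1) =
      eulerCoeff Q (m + 1) * (x * Q) ^ (m + 1) + x * (eulerCoeff Q m * (x * Q) ^ m) := fun m => by
    linear_combination x ^ (m + 1) * eulerCoeff_succ hunit m
  rw [(summable_mul_pow _ hx).tsum_eq_zero_add, tsum_congr hterm,
    ((summable_nat_add_iff 1).2 hs).tsum_add (hs.mul_left x), hs.tsum_mul_left, ← add_assoc,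
    one_add_mul]
  congr 1
  rw [hs.tsum_eq_zero_add]
  simp

theorem tendsto_tsum_mul_pow [IsLinearTopology R R] (f : ℕ → MvPowerSeries σ R)
    {x : ℕ → MvPowerSeries σ R} (hx : ∀ n, (x n).constantCoeff = 0)
    (hlim : Tendsto x atTop (𝓝 0)) : Tendsto (fun n => ∑' m, f m * x n ^ m) atTop (𝓝 (f 0)) := by
  have htail : ∀ n, ∑' m, f m * x n ^ m = f 0 + x n * ∑' m, f (m + 1) * x n ^ m := fun n => by
    rw [(summable_mul_pow f (hx n)).tsum_eq_zero_add,
      ← (summable_mul_pow (fun m => f (m + 1)) (hx n)).tsum_mul_left]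
    congr 1
    · simp
    · exact tsum_congr fun m => by ring
  simp only [htail]
  simpa using (IsLinearTopology.tendsto_mul_zero_of_left _ _ hlim).const_add (f 0)

theorem tsum_eulerCoeff_mul_pow [IsLinearTopology R R] {Q x : MvPowerSeries σ R}
    (hQ : Q.constantCoeff = 0) (hx : x.constantCoeff = 0) :
    ∑' m, eulerCoeff Q m * x ^ m = qPochhammer (-x) Q := by
  have hxQ : ∀ n, (x * Q ^ n).constantCoeff = 0 := by simp [hx]
  have hprod : ∀ n, ∑' m, eulerCoeff Q m * x ^ m =
      (∏ j ∈ range n, (1 - -x * Q ^ j)) * ∑' m, eulerCoeff Q m * (x * Q ^ n) ^ m := fun n => by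
    induction n with
    | zero => simp
    | succ n ih =>
      rw [ih, tsum_eulerCoeff_mul_pow_eq_one_add_mul hQ (hxQ n), prod_range_succ, pow_succ,
        ← mul_assoc x]
      ring
  have hpow : Tendsto (fun n => x * Q ^ n) atTop (𝓝 0) :=
    (summable_mul_pow (fun _ => x) hQ).tendsto_atTop_zero
  have hlim := (qPochhammerConverges (-x) hQ).tendsto_prod_range.mul
    (tendsto_tsum_mul_pow (eulerCoeff Q) hxQ hpow)
  rw [eulerCoeff_zero, mul_one] at hlim
  exact tendsto_nhds_unique (tendsto_const_nhds.congr hprod) hlim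

end Euler

/-! ### The recurrence on the largest part -/

section Recurrence

open Finset

variable {A : Type*} [CommRing A]

/-- The recurrences satisfied by the generating functions of Primc's partitions that can follow a
part `(k + 1)_a` (for `γ k`) or a part `k_c` (for `T k`). The dilated parts `k_a`, `k_b`, `k_c`,
`k_d` have the weights `αQ^(k-1)`, `Q^k`, `cQ^k`, `δQ^k`. -/
structure LargestPartRecurrence (Q α c δ : A) (γ T : ℕ → A) : Prop where
  γ_zero : γ 0 = 1
  γ_one : (1 - Q) * γ 1 = 1
  T_zero : T 0 = 0
  γ_add_two : ∀ k, (1 - Q ^ (k + 2)) * γ (k + 2) =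
    γ (k + 1) + α * Q ^ k * γ k + (c + δ) * Q ^ (k + 1) * T (k + 1)
  T_succ : ∀ k, (1 - c * Q ^ (k + 1)) * T (k + 1) =
    α * Q ^ k * γ k + (1 - Q ^ (k + 1)) * γ (k + 1) - δ * Q ^ k * T k

theorem LargestPartRecurrence.unique {Q α c δ : A} {γ T γ' T' : ℕ → A}
    (h : LargestPartRecurrence Q α c δ γ T) (h' : LargestPartRecurrence Q α c δ γ' T')
    (hQ : ∀ k, IsUnit (1 - Q ^ (k + 1))) (hc : ∀ k, IsUnit (1 - c * Q ^ (k + 1))) : γ = γ' := by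
  have key : ∀ k, γ k = γ' k ∧ γ (k + 1) = γ' (k + 1) ∧ T k = T' k := by
    intro k
    induction k with
    | zero =>
      refine ⟨by rw [h.γ_zero, h'.γ_zero], (hQ 0).mul_left_cancel ?_, by rw [h.T_zero, h'.T_zero]⟩
      rw [zero_add, pow_one, h.γ_one, h'.γ_one]
    | succ k ih =>
      obtain ⟨hγ, hγ', hT⟩ := ih
      have hT' : T (k + 1) = T' (k + 1) := (hc k).mul_left_cancel <| by
        rw [h.T_succ, h'.T_succ, hγ, hγ', hT]
      refine ⟨hγ', (hQ (k + 1)).mul_left_cancel ?_, hT'⟩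
      rw [h.γ_add_two, h'.γ_add_two, hγ, hγ', hT']
  exact funext fun k => (key k).1

open PowerSeries

theorem largestPartRecurrence_coeff {Q α c δ : A} {Γ Τ : A⟦X⟧}
    (hΓ₀ : constantCoeff Γ = 1) (hΤ₀ : constantCoeff Τ = 0)
    (hΓ : (1 - X) * Γ = (1 + C α * X ^ 2) * rescale Q Γ + (C c + C δ) * X * rescale Q Τ)
    (hΤ : Τ - C c * rescale Q Τ =
      C α * X * rescale Q Γ + Γ - rescale Q Γ - C δ * X * rescale Q Τ) :
    LargestPartRecurrence Q α c δ (fun k => coeff k Γ) (fun k => coeff k Τ) := by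
  replace hΓ : Γ - X * Γ = rescale Q Γ + C α * (X * (X * rescale Q Γ)) + C c * (X * rescale Q Τ) +
      C δ * (X * rescale Q Τ) := by linear_combination hΓ
  replace hΤ : Τ - C c * rescale Q Τ = C α * (X * rescale Q Γ) + Γ - rescale Q Γ -
      C δ * (X * rescale Q Τ) := by linear_combination hΤ
  rw [← coeff_zero_eq_constantCoeff_apply] at hΓ₀ hΤ₀
  refine ⟨hΓ₀, ?_, hΤ₀, fun k => ?_, fun k => ?_⟩
  · have := congrArg (coeff (0 + 1)) hΓ
    simp only [map_sub, map_add, coeff_C_mul, coeff_succ_X_mul, coeff_zero_X_mul, coeff_rescale,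
      hΓ₀, hΤ₀] at this
    linear_combination this
  · have := congrArg (coeff (k + 2)) hΓ
    simp only [map_sub, map_add, coeff_C_mul, coeff_succ_X_mul, coeff_rescale] at this
    linear_combination this
  · have := congrArg (coeff (k + 1)) hΤ
    simp only [map_sub, map_add, coeff_C_mul, coeff_succ_X_mul, coeff_rescale] at this
    linear_combination this

theorem largestPartRecurrence_coeff_mul {Q α c δ : A} {E K S : A⟦X⟧}
    (hE₀ : constantCoeff E = 1) (hK₀ : constantCoeff K = 1) (hE : E = (1 + X) * rescale Q E)
    (hK : K - rescale Q K = X ^ 2 * (S + C (δ * Q) * rescale Q S))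
    (hS : S - C (c * Q) * rescale Q S = K + C α * rescale Q K) :
    LargestPartRecurrence Q α c δ (fun k => coeff k (E * K)) (fun k => coeff k (X * E * S)) := by
  simp only [map_mul] at hK hS
  refine largestPartRecurrence_coeff (by simp [hE₀, hK₀]) (by simp) ?_ ?_ <;>
    simp only [map_mul, rescale_X]
  · linear_combination (1 - X) * K * hE + rescale Q E * hK + rescale Q E * X ^ 2 * hS
  · linear_combination (X * S - K) * hE + rescale Q E * X * hS - rescale Q E * hK

theorem mk_eulerCoeff {Q : A} (hQ : ∀ i, IsUnit (1 - Q ^ (i + 1))) :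
    PowerSeries.mk (eulerCoeff Q) = (1 + X) * rescale Q (PowerSeries.mk (eulerCoeff Q)) := by
  ext m
  rw [one_add_mul, map_add]
  cases m with
  | zero => simp
  | succ m =>
    rw [coeff_succ_X_mul]
    simp only [coeff_rescale, coeff_mk]
    linear_combination eulerCoeff_succ hQ m

/-- The coefficient `(a; p)_n (b; p)_n / ((c; p)_n (p; p)_n)` of `z^n` in the basic hypergeometric
series `₂φ₁(a, b; c; p, z)`. -/
noncomputable def hypergeometricCoeff (a b c p : A) (n : ℕ) : A :=
  ∏ j ∈ range n, (1 - a * p ^ j) * (1 - b * p ^ j) *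
    Ring.inverse ((1 - c * p ^ j) * (1 - p * p ^ j))

theorem prod_mul_hypergeometricCoeff (a b : A) {c p : A} (hc : ∀ j, IsUnit (1 - c * p ^ j))
    (hp : ∀ j, IsUnit (1 - p * p ^ j)) (n : ℕ) :
    ((∏ j ∈ range n, (1 - c * p ^ j)) * ∏ j ∈ range n, (1 - p * p ^ j)) *
      hypergeometricCoeff a b c p n =
    (∏ j ∈ range n, (1 - a * p ^ j)) * ∏ j ∈ range n, (1 - b * p ^ j) := by
  simp only [hypergeometricCoeff, ← prod_mul_distrib]
  refine prod_congr rfl fun j _ => ?_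
  rw [mul_comm (_ * _ : A) (Ring.inverse _), Ring.mul_inverse_cancel_left _ _ ((hc j).mul (hp j))]

/-- The coefficients of the companion of `₂φ₁(a, b; c; p, z)` that splits the two-term recurrence
of `hypergeometricCoeff` into two first-order steps. -/
noncomputable def hypergeometricHalfCoeff (a b c p : A) (n : ℕ) : A :=
  Ring.inverse (1 - c * p ^ n) * ((1 - a * p ^ n) * hypergeometricCoeff a b c p n)

theorem mul_hypergeometricCoeff_succ (a b c : A) {p : A} {n : ℕ}
    (hp : IsUnit (1 - p * p ^ n)) :
    (1 - p * p ^ n) * hypergeometricCoeff a b c p (n + 1) =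
      (1 - b * p ^ n) * hypergeometricHalfCoeff a b c p n := by
  rw [hypergeometricHalfCoeff, hypergeometricCoeff, prod_range_succ, ← hypergeometricCoeff,
    Ring.mul_inverse_rev]
  linear_combination (hypergeometricCoeff a b c p n * (1 - a * p ^ n) * (1 - b * p ^ n) *
    Ring.inverse (1 - c * p ^ n)) * Ring.mul_inverse_cancel _ hp

theorem mk_hypergeometricCoeff_sub_rescale (a b c : A) {p : A}
    (hp : ∀ j, IsUnit (1 - p * p ^ j)) :
    PowerSeries.mk (hypergeometricCoeff a b c p) -
        rescale p (PowerSeries.mk (hypergeometricCoeff a b c p)) =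
      X * (PowerSeries.mk (hypergeometricHalfCoeff a b c p) -
        C b * rescale p (PowerSeries.mk (hypergeometricHalfCoeff a b c p))) := by
  ext n
  cases n with
  | zero => rw [coeff_zero_X_mul, map_sub, coeff_rescale, pow_zero, one_mul, sub_self]
  | succ n =>
    simp only [coeff_succ_X_mul, map_sub, coeff_C_mul, coeff_rescale, coeff_mk]
    linear_combination mul_hypergeometricCoeff_succ a b c (hp n)

theorem mk_hypergeometricHalfCoeff_sub_rescale (a b : A) {c p : A}
    (hc : ∀ j, IsUnit (1 - c * p ^ j)) :
    PowerSeries.mk (hypergeometricHalfCoeff a b c p) -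
        C c * rescale p (PowerSeries.mk (hypergeometricHalfCoeff a b c p)) =
      PowerSeries.mk (hypergeometricCoeff a b c p) -
        C a * rescale p (PowerSeries.mk (hypergeometricCoeff a b c p)) := by
  ext n
  simp only [map_sub, coeff_C_mul, coeff_rescale, coeff_mk, hypergeometricHalfCoeff]
  linear_combination ((1 - a * p ^ n) * hypergeometricCoeff a b c p n) *
    Ring.mul_inverse_cancel _ (hc n)

theorem rescale_expand (Q : A) {m : ℕ} (hm : m ≠ 0) (f : A⟦X⟧) :
    rescale Q (expand m hm f) = expand m hm (rescale (Q ^ m) f) := by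
  ext n
  rw [coeff_rescale, coeff_expand, coeff_expand]
  split_ifs with h
  · rw [coeff_rescale, ← pow_mul, Nat.mul_div_cancel' h]
  · rw [mul_zero]

theorem one_add_X_mul_expand_two (f : A⟦X⟧) :
    (1 + X) * expand 2 two_ne_zero f = PowerSeries.mk fun n => coeff (n / 2) f := by
  ext n
  rw [one_add_mul, map_add, coeff_mk]
  cases n with
  | zero => simp [coeff_expand]
  | succ n =>
    rw [coeff_succ_X_mul, coeff_expand, coeff_expand]
    rcases Nat.even_or_odd' n with ⟨k, rfl | rfl⟩
    · have : (2 * k + 1) / 2 = k := by omega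
      simp [this]
    · have h : 2 * k + 1 + 1 = 2 * (k + 1) := by ring
      simp [h]

theorem largestPartRecurrence_eulerCoeff_hypergeometricCoeff {Q : A} (α δ : A) {c : A}
    (hQ : ∀ k, IsUnit (1 - Q ^ (k + 1))) (hc : ∀ k, IsUnit (1 - c * Q ^ (k + 1))) :
    let K := PowerSeries.mk (hypergeometricCoeff (-α) (-(δ * Q)) (c * Q) (Q ^ 2))
    let S := PowerSeries.mk (hypergeometricHalfCoeff (-α) (-(δ * Q)) (c * Q) (Q ^ 2))
    LargestPartRecurrence Q α c δ
      (fun k => coeff k (PowerSeries.mk (eulerCoeff Q) * expand 2 two_ne_zero K))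
      (fun k => coeff k (X * PowerSeries.mk (eulerCoeff Q) * expand 2 two_ne_zero S)) := by
  intro K S
  have hc' : ∀ j, IsUnit (1 - c * Q * (Q ^ 2) ^ j) := fun j => by
    rw [← pow_mul, mul_assoc, ← pow_succ']
    exact hc _
  have hQ' : ∀ j, IsUnit (1 - Q ^ 2 * (Q ^ 2) ^ j) := fun j => by
    rw [← pow_succ', ← pow_mul, mul_add]
    exact hQ _
  have hK := congrArg (expand 2 two_ne_zero)
    (mk_hypergeometricCoeff_sub_rescale (-α) (-(δ * Q)) (c * Q) hQ')
  have hS := congrArg (expand 2 two_ne_zero)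
    (mk_hypergeometricHalfCoeff_sub_rescale (-α) (-(δ * Q)) hc')
  simp only [map_sub, map_mul, map_neg, expand_X, expand_C, ← rescale_expand] at hK hS
  refine largestPartRecurrence_coeff_mul (by simp [eulerCoeff_zero])
    (by simp [hypergeometricCoeff, K]) (mk_eulerCoeff hQ) ?_ ?_ <;> rw [map_mul]
  · linear_combination hK
  · linear_combination hS

theorem LargestPartRecurrence.eq_sum_antidiagonal {Q α c δ : A} {γ T : ℕ → A}
    (h : LargestPartRecurrence Q α c δ γ T)
    (hQ : ∀ k, IsUnit (1 - Q ^ (k + 1))) (hc : ∀ k, IsUnit (1 - c * Q ^ (k + 1))) (n : ℕ) :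
    γ n = ∑ x ∈ antidiagonal n, eulerCoeff Q x.1 * Q ^ x.1 *
      hypergeometricCoeff (-α) (-(δ * Q)) (c * Q) (Q ^ 2) (x.2 / 2) := by
  rw [h.unique (largestPartRecurrence_eulerCoeff_hypergeometricCoeff α δ hQ hc) hQ hc]
  beta_reduce
  rw [mk_eulerCoeff hQ, mul_comm (1 + X), mul_assoc, one_add_X_mul_expand_two, coeff_mul]
  simp only [coeff_rescale, coeff_mk, mul_comm (Q ^ _)]

end Recurrence

section Limit

open Filter Topology Finset

variable {σ R : Type} [CommRing R] [TopologicalSpace R] [IsTopologicalRing R] [T2Space R]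
  [IsLinearTopology R R]

theorem tendsto_hypergeometricCoeff (a b : MvPowerSeries σ R) {c p : MvPowerSeries σ R}
    (hc : c.constantCoeff = 0) (hp : p.constantCoeff = 0) :
    Tendsto (hypergeometricCoeff a b c p) atTop
      (𝓝 (Ring.inverse (qPochhammer c p * qPochhammer p p) *
        (qPochhammer a p * qPochhammer b p))) := by
  have hconv := fun x : MvPowerSeries σ R => (qPochhammerConverges x hp).tendsto_prod_range
  have hc' : ∀ j, IsUnit (1 - c * p ^ j) := fun j => isUnit_one_sub (by simp [hc])
  have hp' : ∀ j, IsUnit (1 - p * p ^ j) := fun j => isUnit_one_sub (by simp [hp])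
  refine tendsto_of_isUnit_of_tendsto_mul
    (u := fun n => (∏ j ∈ range n, (1 - c * p ^ j)) * ∏ j ∈ range n, (1 - p * p ^ j))
    (fun n => (IsUnit.prod_iff.2 fun j _ => hc' j).mul (IsUnit.prod_iff.2 fun j _ => hp' j))
    ((hconv c).mul (hconv p)) ?_
  rw [Ring.mul_inverse_cancel_left _ _ ((isUnit_qPochhammer hc hp).mul (isUnit_qPochhammer hp hp))]
  exact ((hconv a).mul (hconv b)).congr fun n =>
    (prod_mul_hypergeometricCoeff a b hc' hp' n).symm

theorem LargestPartRecurrence.limit_mul_qPochhammer {Q α c δ G : MvPowerSeries σ R}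
    {γ T : ℕ → MvPowerSeries σ R} (h : LargestPartRecurrence Q α c δ γ T)
    (hQ : Q.constantCoeff = 0) (hG : Tendsto γ atTop (𝓝 G)) :
    G * (qPochhammer Q Q * qPochhammer (c * Q) (Q ^ 2)) =
      qPochhammer (-α) (Q ^ 2) * qPochhammer (-(δ * Q)) (Q ^ 2) := by
  have hQ2 : (Q ^ 2).constantCoeff = 0 := by simp [hQ]
  have hcQ : (c * Q).constantCoeff = 0 := by simp [hQ]
  have hunitQ : ∀ k, IsUnit (1 - Q ^ (k + 1)) := fun k => isUnit_one_sub (by simp [hQ])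
  have hunitc : ∀ k, IsUnit (1 - c * Q ^ (k + 1)) := fun k => isUnit_one_sub (by simp [hQ])
  have hE := (summable_mul_pow (eulerCoeff Q) hQ).hasSum
  rw [tsum_eulerCoeff_mul_pow hQ hQ] at hE
  have hφ := (tendsto_hypergeometricCoeff (-α) (-(δ * Q)) hcQ hQ2).comp
    (Nat.tendsto_div_const_atTop (n := 2) two_ne_zero)
  have hGeq := tendsto_nhds_unique hG
    ((tendsto_sum_antidiagonal_mul hE hφ).congr fun n =>
      (h.eq_sum_antidiagonal hunitQ hunitc n).symm)
  have hneg := qPochhammer_mul_qPochhammer_neg (qPochhammerConverges Q hQ)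
    (qPochhammerConverges (-Q) hQ)
  have hunit := (isUnit_qPochhammer hcQ hQ2).mul (isUnit_qPochhammer hQ2 hQ2)
  calc G * (qPochhammer Q Q * qPochhammer (c * Q) (Q ^ 2))
      = qPochhammer (c * Q) (Q ^ 2) * (qPochhammer Q Q * qPochhammer (-Q) Q) *
          (Ring.inverse (qPochhammer (c * Q) (Q ^ 2) * qPochhammer (Q ^ 2) (Q ^ 2)) *
            (qPochhammer (-α) (Q ^ 2) * qPochhammer (-(δ * Q)) (Q ^ 2))) := by rw [hGeq]; ring
    _ = _ := by rw [hneg, Ring.mul_inverse_cancel_left _ _ hunit]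

end Limit

/-! ### Sums over multisets and Euler products -/

section LocallyFinite

open Filter Topology Set

variable {σ R L : Type*} [CommRing R] {f : L → MvPowerSeries σ R} {S T : Set L}

/-- The family `f` of power series is locally finite on `S` if every coefficient is nonzero for
only finitely many of its members, so that it can be summed over every subset of `S` whatever the
topology of the coefficient ring. -/
def IsLocallyFinite (f : L → MvPowerSeries σ R) (S : Set L) : Prop :=
  ∀ e, {x ∈ S | MvPowerSeries.coeff e (f x) ≠ 0}.Finite

theorem IsLocallyFinite.mono (h : IsLocallyFinite f T) (hST : S ⊆ T) : IsLocallyFinite f S :=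
  fun e => (h e).subset fun _ hx => ⟨hST hx.1, hx.2⟩

variable [TopologicalSpace R]

theorem IsLocallyFinite.summable (h : IsLocallyFinite f S) : Summable fun x : S => f x := by
  refine MvPowerSeries.WithPiTopology.summable_iff_summable_coeff.2 fun e =>
    summable_of_hasFiniteSupport ?_
  exact ((h e).preimage Subtype.val_injective.injOn).subset fun x hx => ⟨x.2, hx⟩

variable [T2Space R]

theorem IsLocallyFinite.coeff_tsum (h : IsLocallyFinite f S) (e : σ →₀ ℕ) :
    MvPowerSeries.coeff e (∑' x : S, f x) =
      ∑' x, S.indicator (fun x => MvPowerSeries.coeff e (f x)) x := by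
  rw [← tsum_subtype]
  exact (MvPowerSeries.WithPiTopology.hasSum_iff_hasSum_coeff.1 h.summable.hasSum e).tsum_eq.symm

theorem IsLocallyFinite.tendsto_tsum {ι : Type*} {l : Filter ι} {S : ι → Set L}
    (h : IsLocallyFinite f T) (hS : ∀ i, S i ⊆ T) (hT : ∀ x ∈ T, ∀ᶠ i in l, x ∈ S i) :
    Tendsto (fun i => ∑' x : S i, f x) l (𝓝 (∑' x : T, f x)) := by
  refine (MvPowerSeries.WithPiTopology.tendsto_iff_coeff_tendsto ..).2 fun e => ?_
  refine tendsto_const_nhds.congr' ?_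
  filter_upwards [(h e).eventually_all.2 fun x hx => hT x hx.1] with i hi
  rw [h.coeff_tsum, (h.mono (hS i)).coeff_tsum]
  refine tsum_congr fun x => ?_
  by_cases hx : x ∈ T ∧ MvPowerSeries.coeff e (f x) ≠ 0
  · rw [indicator_of_mem hx.1, indicator_of_mem (hi x hx)]
  · have hzero : ∀ U ⊆ T, U.indicator (fun x => MvPowerSeries.coeff e (f x)) x = 0 := fun U hU =>
      indicator_apply_eq_zero (f := fun x => MvPowerSeries.coeff e (f x)).2 fun hxU =>
        not_and_not_right.1 hx (hU hxU)
    rw [hzero T subset_rfl, hzero (S i) (hS i)]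

theorem IsLocallyFinite.tsum_union (h : IsLocallyFinite f (S ∪ T)) [IsTopologicalRing R]
    (hd : Disjoint S T) : ∑' x : ↑(S ∪ T), f x = ∑' x : S, f x + ∑' x : T, f x :=
  (h.mono subset_union_left).summable.tsum_union_disjoint hd (h.mono subset_union_right).summable

theorem coeff_tsum_monomial {g : L → σ →₀ ℕ} (hg : ∀ e, {x ∈ S | g x = e}.Finite) (e : σ →₀ ℕ) :
    MvPowerSeries.coeff e (∑' x : S, MvPowerSeries.monomial (g x) (1 : R)) =
      {x ∈ S | g x = e}.ncard := by
  classical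
  have hf : IsLocallyFinite (fun x => MvPowerSeries.monomial (g x) (1 : R)) S := fun e =>
    (hg e).subset fun x hx => ⟨hx.1, by
      by_contra hne
      exact hx.2 (MvPowerSeries.coeff_monomial_ne (Ne.symm hne) _)⟩
  have hind : (S.indicator fun x => MvPowerSeries.coeff e (MvPowerSeries.monomial (g x) (1 : R))) =
      ({x ∈ S | g x = e} : Set L).indicator 1 := by
    ext x
    simp only [indicator_apply, MvPowerSeries.coeff_monomial, mem_ofPred_eq, ite_and, eq_comm,
      Pi.one_apply]
  rw [hf.coeff_tsum, hind, ← (hg e).coe_toFinset, ← tsum_subtype, Set.ncard_coe_finset]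
  simp

end LocallyFinite

section Multisets

open Set

variable {X : Type*} [DecidableEq X] {U V U' V' : Set X} {x : X}

/-- The multisets of elements of `U ∪ V` in which the elements of `V` are not repeated. -/
def multisetsOn (U V : Set X) : Set (Multiset X) :=
  {p | (∀ x ∈ p, x ∈ U ∪ V) ∧ ∀ x ∈ V, p.count x ≤ 1}

theorem multisetsOn_empty : multisetsOn (∅ : Set X) ∅ = {0} := by
  ext p
  simp [multisetsOn, Multiset.eq_zero_iff_forall_notMem]

theorem multisetsOn_mono (hU : U ⊆ U') (hV : V ⊆ V') (hd : Disjoint U' V') :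
    multisetsOn U V ⊆ multisetsOn U' V' := by
  refine fun p hp => ⟨fun x hx => union_subset_union hU hV (hp.1 x hx), fun x hx => ?_⟩
  by_cases hxp : x ∈ p
  · rcases hp.1 x hxp with hxU | hxV
    · exact absurd hx (hd.notMem_of_mem_left (hU hxU))
    · exact hp.2 x hxV
  · simp [Multiset.count_eq_zero_of_notMem hxp]

theorem multisetsOn_insert_left (hV : x ∉ V) :
    multisetsOn (insert x U) V = multisetsOn U V ∪ (x ::ₘ ·) '' multisetsOn (insert x U) V := by
  refine Subset.antisymm (fun p hp => ?_) (union_subset ?_ ?_)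
  · by_cases hxp : x ∈ p
    · obtain ⟨p, rfl⟩ := Multiset.exists_cons_of_mem hxp
      exact Or.inr ⟨p, ⟨fun y hy => hp.1 y (Multiset.mem_cons_of_mem hy), fun y hy =>
        (Multiset.count_le_count_cons y x p).trans (hp.2 y hy)⟩, rfl⟩
    · refine Or.inl ⟨fun y hy => ?_, hp.2⟩
      have hyx : y ≠ x := ne_of_mem_of_not_mem hy hxp
      simpa [hyx] using hp.1 y hy
  · exact fun p hp => ⟨fun y hy => by simpa [or_assoc] using Or.inr (hp.1 y hy), hp.2⟩
  · rintro _ ⟨p, hp, rfl⟩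
    refine ⟨fun y hy => ?_, fun y hy => ?_⟩
    · rcases Multiset.mem_cons.1 hy with rfl | hy
      · simp
      · exact hp.1 y hy
    · rw [Multiset.count_cons_of_ne (ne_of_mem_of_not_mem hy hV)]
      exact hp.2 y hy

theorem multisetsOn_insert_right (hU : x ∉ U) (hV : x ∉ V) :
    multisetsOn U (insert x V) = multisetsOn U V ∪ (x ::ₘ ·) '' multisetsOn U V := by
  refine Subset.antisymm (fun p hp => ?_) (union_subset ?_ ?_)
  · have hmem : ∀ y ∈ p, y ≠ x → y ∈ U ∪ V := fun y hy hyx => by simpa [hyx] using hp.1 y hy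
    by_cases hxp : x ∈ p
    · obtain ⟨p, rfl⟩ := Multiset.exists_cons_of_mem hxp
      have hxp' : x ∉ p := by
        have := hp.2 x (mem_insert x V)
        rw [Multiset.count_cons_self] at this
        exact Multiset.count_eq_zero.1 (by omega)
      exact Or.inr ⟨p, ⟨fun y hy => hmem y (Multiset.mem_cons_of_mem hy)
        (ne_of_mem_of_not_mem hy hxp'), fun y hy => (Multiset.count_le_count_cons y x p).trans
          (hp.2 y (mem_insert_of_mem x hy))⟩, rfl⟩
    · exact Or.inl ⟨fun y hy => hmem y hy (ne_of_mem_of_not_mem hy hxp),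
        fun y hy => hp.2 y (mem_insert_of_mem x hy)⟩
  · refine fun p hp => ⟨fun y hy => ?_, fun y hy => ?_⟩
    · exact (hp.1 y hy).imp_right (mem_insert_of_mem x)
    · rcases hy with rfl | hy
      · rw [Multiset.count_eq_zero_of_notMem fun hyp => not_or.2 ⟨hU, hV⟩ (hp.1 y hyp)]
        exact zero_le_one
      · exact hp.2 y hy
  · rintro _ ⟨p, hp, rfl⟩
    have hxp : x ∉ p := fun hxp => not_or.2 ⟨hU, hV⟩ (hp.1 x hxp)
    refine ⟨fun y hy => ?_, fun y hy => ?_⟩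
    · rcases Multiset.mem_cons.1 hy with rfl | hy
      · simp
      · exact (hp.1 y hy).imp_right (mem_insert_of_mem x)
    · rcases hy with rfl | hy
      · rw [Multiset.count_cons_self, Multiset.count_eq_zero_of_notMem hxp]
      · rw [Multiset.count_cons_of_ne (ne_of_mem_of_not_mem hy hV)]
        exact hp.2 y hy

theorem disjoint_multisetsOn_image_cons (hU : x ∉ U) (hV : x ∉ V) (S : Set (Multiset X)) :
    Disjoint (multisetsOn U V) ((x ::ₘ ·) '' S) := by
  rw [disjoint_left]
  rintro _ hp ⟨p, -, rfl⟩
  exact not_or.2 ⟨hU, hV⟩ (hp.1 x (Multiset.mem_cons_self x p))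

end Multisets

section EulerProduct

open Filter Set

variable {σ R X : Type*} [CommRing R] [TopologicalSpace R] [IsTopologicalRing R] [T2Space R]
  {w : X → MvPowerSeries σ R}

theorem tsum_prod_map_cons (x : X) {S : Set (Multiset X)}
    (h : IsLocallyFinite (fun p => (p.map w).prod) S) :
    ∑' p : (x ::ₘ ·) '' S, ((p : Multiset X).map w).prod =
      w x * ∑' p : S, ((p : Multiset X).map w).prod := by
  rw [tsum_image (fun p : Multiset X => (p.map w).prod)
    fun _ _ _ _ => (Multiset.cons_inj_right x).1, ← h.summable.tsum_mul_left]
  simp only [Multiset.map_cons, Multiset.prod_cons]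

variable [DecidableEq X]

theorem tsum_multisetsOn_finset_mul_prod {s t : Finset X} (hd : Disjoint (s : Set X) t)
    (h : IsLocallyFinite (fun p => (p.map w).prod) (multisetsOn (s : Set X) t)) :
    (∑' p : multisetsOn (s : Set X) t, ((p : Multiset X).map w).prod) * ∏ x ∈ s, (1 - w x) =
      ∏ x ∈ t, (1 + w x) := by
  induction t using Finset.induction_on with
  | empty =>
    induction s using Finset.induction_on with
    | empty =>
      rw [Finset.coe_empty, multisetsOn_empty, tsum_singleton (0 : Multiset X)
        fun p : Multiset X => (p.map w).prod]
      simp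
    | insert x s hx ih =>
      rw [Finset.coe_insert] at h ⊢
      have hxs : x ∉ (s : Set X) := hx
      have hrec := h
      rw [multisetsOn_insert_left (by simp)] at hrec
      have hstep := hrec.tsum_union (disjoint_multisetsOn_image_cons hxs (by simp) _)
      rw [← multisetsOn_insert_left (by simp), tsum_prod_map_cons x h] at hstep
      rw [Finset.prod_insert hx, ← ih (by simp) (hrec.mono subset_union_left)]
      linear_combination (∏ y ∈ s, (1 - w y)) * hstep
  | insert x t hx ih =>
    rw [Finset.coe_insert] at h hd ⊢
    rw [disjoint_insert_right] at hd
    rw [multisetsOn_insert_right hd.1 hx] at h ⊢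
    have hUV := h.mono subset_union_left
    rw [h.tsum_union (disjoint_multisetsOn_image_cons hd.1 hx _), tsum_prod_map_cons x hUV,
      Finset.prod_insert hx, ← ih hd.2 hUV]
    ring

theorem tsum_multisetsOn_mul {U V : Set X} {u v : MvPowerSeries σ R} (hd : Disjoint U V)
    (h : IsLocallyFinite (fun p => (p.map w).prod) (multisetsOn U V))
    (hu : HasProd (fun x : U => 1 - w x) u) (hv : HasProd (fun x : V => 1 + w x) v) :
    (∑' p : multisetsOn U V, ((p : Multiset X).map w).prod) * u = v := by
  let coeSet (W : Set X) (s : Finset W) : Finset X := s.map (Function.Embedding.subtype _)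
  have hsub : ∀ {W : Set X} (s : Finset W), (coeSet W s : Set X) ⊆ W := fun s => by
    simp [coeSet]
  have hev : ∀ {W : Set X} {x : X}, x ∈ W → ∀ᶠ s in atTop, x ∈ coeSet W s := fun {W x} hx => by
    filter_upwards [eventually_ge_atTop {⟨x, hx⟩}] with s hs
    simpa [coeSet, hx] using hs
  have hlim := h.tendsto_tsum (l := atTop ×ˢ atTop)
    (S := fun st : Finset U × Finset V => multisetsOn (coeSet U st.1 : Set X) (coeSet V st.2))
    (fun st => multisetsOn_mono (hsub _) (hsub _) hd) fun p hp => by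
      have hmem : ∀ x ∈ p.toFinset, ∀ᶠ st : Finset U × Finset V in atTop ×ˢ atTop,
          x ∈ coeSet U st.1 ∨ x ∈ coeSet V st.2 := fun x hx =>
        (hp.1 x (Multiset.mem_toFinset.1 hx)).elim
          (fun hx => (tendsto_fst.eventually (hev hx)).mono fun _ => Or.inl)
          fun hx => (tendsto_snd.eventually (hev hx)).mono fun _ => Or.inr
      filter_upwards [(Finset.eventually_all p.toFinset).2 hmem] with st hst
      exact ⟨fun x hx => hst x (Multiset.mem_toFinset.2 hx), fun x hx => hp.2 x (hsub _ hx)⟩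
  rw [HasProd, SummationFilter.unconditional_filter] at hu hv
  refine tendsto_nhds_unique (hlim.mul (hu.comp tendsto_fst)) ((hv.comp tendsto_snd).congr ?_)
  intro st
  have := tsum_multisetsOn_finset_mul_prod (w := w) (hd.mono (hsub st.1) (hsub st.2))
    (h.mono (multisetsOn_mono (hsub _) (hsub _) hd))
  simpa [coeSet] using this.symm

end EulerProduct

/-! ### Generating functions of coloured partitions -/

section LocallyFinitePartitions

variable {σ R C : Type} [CommRing R]

theorem IsLocallyFinite.comp_injOn {K L : Type*} {f : L → MvPowerSeries σ R} {g : K → L}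
    {S : Set K} {T : Set L} (h : IsLocallyFinite f T) (hg : S.InjOn g) (hST : Set.MapsTo g S T) :
    IsLocallyFinite (f ∘ g) S := fun e =>
  Set.Finite.of_finite_image ((h e).subset (by rintro _ ⟨x, hx, rfl⟩; exact ⟨hST hx.1, hx.2⟩))
    (hg.mono (Set.sep_subset _ _))

theorem size_le_order_prod_map {w : ℕ × C → MvPowerSeries σ R} {p : Multiset (ℕ × C)}
    (hw : ∀ x ∈ p, (x.1 : ℕ∞) ≤ (w x).order) : (size p : ℕ∞) ≤ (p.map w).prod.order := by
  induction p using Multiset.induction_on with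
  | empty => simp [size]
  | cons x p ih =>
    simp only [size, Multiset.map_cons, Multiset.sum_cons, Multiset.prod_cons, Nat.cast_add]
    exact (add_le_add (hw x (Multiset.mem_cons_self x p))
      (ih fun y hy => hw y (Multiset.mem_cons_of_mem hy))).trans MvPowerSeries.le_order_mul

theorem isLocallyFinite_prod_map [Finite C] {w : ℕ × C → MvPowerSeries σ R}
    {S : Set (Multiset (ℕ × C))} (hS : ∀ p ∈ S, IsColouredPartition p)
    (hw : ∀ p ∈ S, ∀ x ∈ p, (x.1 : ℕ∞) ≤ (w x).order) :
    IsLocallyFinite (fun p => (p.map w).prod) S := by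
  intro e
  refine ((Set.finite_Iic e.degree).biUnion fun n _ =>
    finite_colouredPartitions (C := C) n).subset fun p hp => ?_
  simp only [Set.mem_iUnion]
  refine ⟨size p, ?_, hS p hp.1, rfl⟩
  exact_mod_cast (size_le_order_prod_map (hw p hp.1)).trans (MvPowerSeries.order_le hp.2)

end LocallyFinitePartitions

section PartWeight

theorem prod_map_pow_fst {M C : Type*} [CommMonoid M] (q : M) (p : Multiset (ℕ × C)) :
    (p.map fun x => q ^ x.1).prod = q ^ (p.map Prod.fst).sum := by
  induction p using Multiset.induction_on with
  | empty => simp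
  | cons x p ih => simp [pow_add, ih]

theorem prod_map_ite_one {M X : Type*} [CommMonoid M] (P : X → Prop) [DecidablePred P] (z : M)
    (p : Multiset X) : (p.map fun x => if P x then z else 1).prod = z ^ p.countP P := by
  induction p using Multiset.induction_on with
  | empty => simp
  | cons x p ih => by_cases hx : P x <;> simp [hx, ih, pow_succ']

variable {C : Type} (Pa Pc Pd : ℕ × C → Prop)
  [DecidablePred Pa] [DecidablePred Pc] [DecidablePred Pd]

/-- The weight `q ^ s` of a part of size `s`, times a factor `a`, `c`, `d` if the part is counted
by the statistic `Pa`, `Pc`, `Pd`. -/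
def partWeight {M : Type*} [CommMonoid M] (q a c d : M) (x : ℕ × C) : M :=
  q ^ x.1 * (if Pa x then a else 1) * (if Pc x then c else 1) * (if Pd x then d else 1)

theorem prod_map_partWeight {M : Type*} [CommMonoid M] (q a c d : M) (p : Multiset (ℕ × C)) :
    (p.map (partWeight Pa Pc Pd q a c d)).prod =
      q ^ size p * a ^ p.countP Pa * c ^ p.countP Pc * d ^ p.countP Pd := by
  unfold partWeight
  simp only [Multiset.prod_map_mul, prod_map_pow_fst, prod_map_ite_one, size]

variable {σ R : Type} [CommRing R]

theorem le_order_partWeight {q : MvPowerSeries σ R} (hq : q.constantCoeff = 0)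
    (a c d : MvPowerSeries σ R) (x : ℕ × C) :
    (x.1 : ℕ∞) ≤ (partWeight Pa Pc Pd q a c d x).order := by
  rw [partWeight, mul_assoc, mul_assoc]
  exact ((MvPowerSeries.le_order_pow_of_constantCoeff_eq_zero x.1 hq).trans le_self_add).trans
    MvPowerSeries.le_order_mul

variable [Finite C] {S : Set (Multiset (ℕ × C))}

theorem isLocallyFinite_prod_map_partWeight (hS : ∀ p ∈ S, IsColouredPartition p)
    {q : MvPowerSeries σ R} (hq : q.constantCoeff = 0) (a c d : MvPowerSeries σ R) :
    IsLocallyFinite (fun p => (p.map (partWeight Pa Pc Pd q a c d)).prod) S :=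
  isLocallyFinite_prod_map hS fun _ _ x _ => le_order_partWeight Pa Pc Pd hq a c d x

theorem genFun_eq_tsum (hS : ∀ p ∈ S, IsColouredPartition p) {F : ℕ → ℕ → ℕ → ℕ → ℕ}
    (hF : ∀ n k l m, F n k l m = {p ∈ S | size p = n ∧
      p.countP Pa = k ∧ p.countP Pc = l ∧ p.countP Pd = m}.ncard) :
    genFun F = ∑' p : S, ((p : Multiset (ℕ × C)).map
      (partWeight Pa Pc Pd (var .q) (var .a) (var .c) (var .d))).prod := by
  let exponent (p : Multiset (ℕ × C)) : Var →₀ ℕ := Finsupp.single .q (size p) +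
    Finsupp.single .a (p.countP Pa) + Finsupp.single .c (p.countP Pc) +
      Finsupp.single .d (p.countP Pd)
  have hexp : ∀ p e, exponent p = e ↔ size p = e .q ∧
      p.countP Pa = e .a ∧ p.countP Pc = e .c ∧ p.countP Pd = e .d := fun p e => by
    constructor
    · rintro rfl
      simp [exponent]
    · rintro ⟨hq, ha, hc, hd⟩
      ext (_ | _ | _ | _) <;> simp [exponent, *]
  have hweight : ∀ p : Multiset (ℕ × C),
      (p.map (partWeight Pa Pc Pd (var .q) (var .a) (var .c) (var .d))).prod =
        MvPowerSeries.monomial (exponent p) 1 := fun p => by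
    simp only [prod_map_partWeight, var, MvPowerSeries.X_pow_eq,
      MvPowerSeries.monomial_mul_monomial, mul_one, exponent]
  ext e
  simp only [hweight]
  rw [coeff_tsum_monomial fun e => (finite_colouredPartitions (C := C) (e .q)).subset fun p hp =>
    ⟨hS p hp.1, ((hexp p e).1 hp.2).1⟩]
  simp only [hexp, ← hF]
  rfl

theorem powerSeries_mk_ncard (hS : ∀ p ∈ S, IsColouredPartition p) :
    PowerSeries.mk (fun n => ({p ∈ S | size p = n}.ncard : ℤ)) =
      ∑' p : S, (PowerSeries.X : PowerSeries ℤ) ^ size (p : Multiset (ℕ × C)) := by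
  have hfin : ∀ e : Unit →₀ ℕ, {p ∈ S | Finsupp.single () (size p) = e}.Finite := fun e =>
    (finite_colouredPartitions (C := C) (e ())).subset fun p hp => ⟨hS p hp.1, by simp [← hp.2]⟩
  ext n
  simp only [PowerSeries.X, MvPowerSeries.X_pow_eq]
  rw [PowerSeries.coeff_mk, PowerSeries.coeff, coeff_tsum_monomial hfin]
  simp only [(Finsupp.single_injective ()).eq_iff]

end PartWeight

/-! ### Partitions with distinct odd parts -/

section DistinctOddPartitions

instance : Finite Colour :=
  Finite.of_surjective (fun b : Bool => if b then Colour.red else Colour.green)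
    (by rintro (_ | _) <;> simp)

/-- The partitions counted by `B₂`. -/
def distinctOddPartitions : Set (Multiset (ℕ × Colour)) :=
  {p | IsColouredPartition p ∧ ((p.map Prod.fst).filter (fun s => Odd s)).Nodup ∧
    ∀ x ∈ p, x.2 = Colour.green → x.1 % 4 = 2}

/-- The weight of a part of size `s` in the generating function of `B₂`: the factor `q ^ s`, and `a`
if `s ≡ 1` modulo `4`, `c` if the part is green, `d` if `s ≡ 3` modulo `4`. -/
def residueWeight {M : Type*} [CommMonoid M] (q a c d : M) : ℕ × Colour → M :=
  partWeight (·.1 % 4 = 1) (·.2 = Colour.green) (·.1 % 4 = 3) q a c d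

/-- The parts that may be repeated in a partition counted by `B₂`. -/
def evenParts : Set (ℕ × Colour) :=
  Set.range (fun j => (2 * j + 2, Colour.red)) ∪ Set.range fun j => (4 * j + 2, Colour.green)

/-- The parts that may not be repeated in a partition counted by `B₂`. -/
def oddParts : Set (ℕ × Colour) :=
  Set.range (fun j => (4 * j + 1, Colour.red)) ∪ Set.range fun j => (4 * j + 3, Colour.red)

theorem mem_evenParts {x : ℕ × Colour} :
    x ∈ evenParts ↔ 0 < x.1 ∧ Even x.1 ∧ (x.2 = Colour.green → x.1 % 4 = 2) := by
  obtain ⟨s, _ | _⟩ := x <;>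
    simp only [evenParts, Set.mem_union, Set.mem_range, Prod.mk.injEq, and_true, reduceCtorEq,
      and_false, exists_const, or_false, false_or, Nat.even_iff, IsEmpty.forall_iff, forall_const]
  · exact ⟨by rintro ⟨j, rfl⟩; omega, fun h => ⟨s / 2 - 1, by omega⟩⟩
  · exact ⟨by rintro ⟨j, rfl⟩; omega, fun h => ⟨s / 4, by omega⟩⟩

theorem mem_oddParts {x : ℕ × Colour} : x ∈ oddParts ↔ Odd x.1 ∧ x.2 = Colour.red := by
  obtain ⟨s, colour⟩ := x
  simp only [oddParts, Set.mem_union, Set.mem_range, Prod.mk.injEq, Nat.odd_iff]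
  constructor
  · rintro (⟨j, rfl, rfl⟩ | ⟨j, rfl, rfl⟩) <;> exact ⟨by omega, rfl⟩
  · rintro ⟨hs, rfl⟩
    rcases (by omega : s % 4 = 1 ∨ s % 4 = 3) with h | h
    · exact Or.inl ⟨s / 4, by omega, rfl⟩
    · exact Or.inr ⟨s / 4, by omega, rfl⟩

theorem disjoint_evenParts_oddParts : Disjoint evenParts oddParts :=
  Set.disjoint_left.2 fun _ hx hx' =>
    Nat.not_even_iff_odd.2 (mem_oddParts.1 hx').1 (mem_evenParts.1 hx).2.1

theorem count_map_fst_of_odd {p : Multiset (ℕ × Colour)}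
    (hgreen : ∀ x ∈ p, x.2 = Colour.green → x.1 % 4 = 2) {s : ℕ} (hs : Odd s) :
    (p.map Prod.fst).count s = p.count (s, Colour.red) := by
  rw [Multiset.count_map, Multiset.count_eq_card_filter_eq]
  refine congrArg Multiset.card (Multiset.filter_congr fun x hx => ?_)
  rw [Nat.odd_iff] at hs
  refine ⟨?_, fun h => congrArg Prod.fst h⟩
  rintro rfl
  rcases hcolour : x.2 with _ | _
  · exact Prod.ext rfl hcolour.symm
  · have := hgreen x hx hcolour
    omega

theorem distinctOddPartitions_eq : distinctOddPartitions = multisetsOn evenParts oddParts := by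
  have hparts : ∀ x : ℕ × Colour,
      x ∈ evenParts ∪ oddParts ↔ 0 < x.1 ∧ (x.2 = Colour.green → x.1 % 4 = 2) := fun x => by
    rw [Set.mem_union, mem_evenParts, mem_oddParts, Nat.even_iff, Nat.odd_iff]
    cases x.2 <;> simp <;> omega
  ext p
  simp only [distinctOddPartitions, multisetsOn, IsColouredPartition, Set.mem_ofPred_eq, hparts,
    forall₂_and, and_assoc]
  refine and_congr_right fun _ => and_comm.trans (and_congr_right fun hgreen => ?_)
  rw [Multiset.nodup_iff_count_le_one]
  refine ⟨fun h x hx => ?_, fun h s => ?_⟩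
  · obtain ⟨hs, hred⟩ := mem_oddParts.1 hx
    have := h x.1
    rwa [Multiset.count_filter_of_pos hs, count_map_fst_of_odd hgreen hs, ← hred] at this
  · rw [Multiset.count_filter]
    split_ifs with hs
    · rw [count_map_fst_of_odd hgreen hs]
      exact h _ (mem_oddParts.2 ⟨hs, rfl⟩)
    · exact zero_le_one

theorem genFun_B₂ : genFun B₂ = ∑' p : distinctOddPartitions, ((p : Multiset (ℕ × Colour)).map
    (residueWeight (var .q) (var .a) (var .c) (var .d))).prod :=
  genFun_eq_tsum _ _ _ (fun _ hp => hp.1) fun n k l m => by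
    rw [B₂]
    congr 1
    ext p
    simp only [distinctOddPartitions, Set.mem_ofPred_eq]
    tauto

theorem hasProd_range_qPochhammer {A X : Type} [CommRing A] [TopologicalSpace A] {x t : A}
    (h : QPochhammerConverges x t) {g : ℕ → X} (hg : g.Injective) {f : X → A}
    (hf : ∀ j, f (g j) = 1 - x * t ^ j) : HasProd (fun y : Set.range g => f y) (qPochhammer x t) :=
  hg.hasProd_range_iff.2 ((funext hf : f ∘ g = _) ▸ h.hasProd)

variable {σ R : Type} [CommRing R] [TopologicalSpace R] [IsTopologicalRing R]
  {q : MvPowerSeries σ R}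

theorem hasProd_evenParts (hq : q.constantCoeff = 0) (a c d : MvPowerSeries σ R) :
    HasProd (fun x : evenParts => 1 - residueWeight q a c d x)
      (qPochhammer (q ^ 2) (q ^ 2) * qPochhammer (c * q ^ 2) (q ^ 4)) := by
  have hred : HasProd
      (fun x : Set.range fun j => (2 * j + 2, Colour.red) => 1 - residueWeight q a c d x)
      (qPochhammer (q ^ 2) (q ^ 2)) := by
    refine hasProd_range_qPochhammer (f := fun x => 1 - residueWeight q a c d x)
      (qPochhammerConverges _ (by simp [hq])) (fun i j h => by simpa using h) fun j => ?_
    have h1 : (2 * j + 2) % 4 ≠ 1 := by omega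
    have h3 : (2 * j + 2) % 4 ≠ 3 := by omega
    simp only [residueWeight, partWeight, h1, h3, ↓reduceIte, reduceCtorEq, mul_one]
    ring
  have hgreen : HasProd
      (fun x : Set.range fun j => (4 * j + 2, Colour.green) => 1 - residueWeight q a c d x)
      (qPochhammer (c * q ^ 2) (q ^ 4)) := by
    refine hasProd_range_qPochhammer (f := fun x => 1 - residueWeight q a c d x)
      (qPochhammerConverges _ (by simp [hq])) (fun i j h => by simpa using h) fun j => ?_
    have h1 : (4 * j + 2) % 4 ≠ 1 := by omega
    have h3 : (4 * j + 2) % 4 ≠ 3 := by omega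
    simp only [residueWeight, partWeight, h1, h3, ↓reduceIte, mul_one]
    ring
  exact HasProd.mul_disjoint (f := fun x => 1 - residueWeight q a c d x)
    (by simp [Set.disjoint_left]) hred hgreen

theorem hasProd_oddParts (hq : q.constantCoeff = 0) (a c d : MvPowerSeries σ R) :
    HasProd (fun x : oddParts => 1 + residueWeight q a c d x)
      (qPochhammer (-(a * q)) (q ^ 4) * qPochhammer (-(d * q ^ 3)) (q ^ 4)) := by
  have hone : HasProd
      (fun x : Set.range fun j => (4 * j + 1, Colour.red) => 1 + residueWeight q a c d x)
      (qPochhammer (-(a * q)) (q ^ 4)) := by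
    refine hasProd_range_qPochhammer (f := fun x => 1 + residueWeight q a c d x)
      (qPochhammerConverges _ (by simp [hq])) (fun i j h => by simpa using h) fun j => ?_
    have h1 : (4 * j + 1) % 4 = 1 := by omega
    simp only [residueWeight, partWeight, h1, OfNat.one_ne_ofNat, ↓reduceIte, reduceCtorEq,
      mul_one]
    ring
  have hthree : HasProd
      (fun x : Set.range fun j => (4 * j + 3, Colour.red) => 1 + residueWeight q a c d x)
      (qPochhammer (-(d * q ^ 3)) (q ^ 4)) := by
    refine hasProd_range_qPochhammer (f := fun x => 1 + residueWeight q a c d x)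
      (qPochhammerConverges _ (by simp [hq])) (fun i j h => by simpa using h) fun j => ?_
    have h3 : (4 * j + 3) % 4 = 3 := by omega
    simp only [residueWeight, partWeight, h3, OfNat.ofNat_ne_one, ↓reduceIte, reduceCtorEq,
      mul_one]
    ring
  refine HasProd.mul_disjoint (f := fun x => 1 + residueWeight q a c d x)
    (Set.disjoint_left.2 ?_) hone hthree
  rintro _ ⟨i, rfl⟩ ⟨j, hij⟩
  rw [Prod.mk.injEq] at hij
  omega

theorem tsum_distinctOddPartitions_mul [T2Space R] (hq : q.constantCoeff = 0)
    (a c d : MvPowerSeries σ R) :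
    (∑' p : distinctOddPartitions,
        ((p : Multiset (ℕ × Colour)).map (residueWeight q a c d)).prod) *
      (qPochhammer (q ^ 2) (q ^ 2) * qPochhammer (c * q ^ 2) (q ^ 4)) =
    qPochhammer (-(a * q)) (q ^ 4) * qPochhammer (-(d * q ^ 3)) (q ^ 4) := by
  have hfin : IsLocallyFinite (fun p => (p.map (residueWeight q a c d)).prod)
      distinctOddPartitions :=
    isLocallyFinite_prod_map_partWeight _ _ _ (fun _ hp => hp.1) hq a c d
  rw [distinctOddPartitions_eq] at hfin ⊢
  exact tsum_multisetsOn_mul disjoint_evenParts_oddParts hfin (hasProd_evenParts hq a c d)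
    (hasProd_oddParts hq a c d)

end DistinctOddPartitions

/-! ### Dilation of Primc's partitions -/

section PrimcLists

/-- The relation between a part and the next one in Primc's partitions. -/
def PrimcRel (x y : ℕ × Fin 4) : Prop :=
  (y.1 < x.1 ∨ (y.1 = x.1 ∧ y.2 ≤ x.2)) ∧ y.1 + primcMatrix x.2 y.2 ≤ x.1

/-- Primc's partitions, as non-increasing lists. -/
def primcLists : Set (List (ℕ × Fin 4)) :=
  {l | (∀ x ∈ l, 0 < x.1) ∧ l.IsChain PrimcRel}

theorem nil_mem_primcLists : [] ∈ primcLists := by simp [primcLists]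

theorem cons_mem_primcLists {x : ℕ × Fin 4} {l : List (ℕ × Fin 4)} :
    x :: l ∈ primcLists ↔ 0 < x.1 ∧ (∀ y ∈ l.head?, PrimcRel x y) ∧ l ∈ primcLists := by
  simp only [primcLists, Set.mem_ofPred_eq, List.mem_cons, forall_eq_or_imp, List.isChain_cons]
  tauto

theorem primcLists_injOn_coe :
    primcLists.InjOn (Multiset.ofList : List (ℕ × Fin 4) → Multiset (ℕ × Fin 4)) := by
  let ge (x y : ℕ × Fin 4) : Prop := toLex y ≤ toLex x
  have : IsTrans (ℕ × Fin 4) ge := ⟨fun _ _ _ hxy hyz => le_trans hyz hxy⟩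
  have hsorted : ∀ l ∈ primcLists, l.Pairwise ge := fun l hl =>
    (hl.2.imp fun _ _ h => Prod.Lex.toLex_le_toLex.2 h.1).pairwise
  exact fun l hl l' hl' h => (Multiset.coe_eq_coe.1 h).eq_of_pairwise
    (fun _ _ _ _ hxy hyx => toLex.injective (le_antisymm hyx hxy)) (hsorted l hl) (hsorted l' hl')

end PrimcLists

section Dilation

/-- The two-coloured part obtained by dilating a part of one of Primc's partitions: the colours
`a` and `c` become red, `b` and `d` green. -/
def dilate (x : ℕ × Fin 4) : ℕ × Colour :=
  (primcDilation x, ![Colour.red, Colour.green, Colour.red, Colour.green] x.2)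

/-- The inverse of `dilate`, from the positive two-coloured parts other than a green `1`. -/
def contract : ℕ × Colour → ℕ × Fin 4
  | (s, Colour.red) => if Odd s then ((s + 1) / 2, 0) else (s / 2, 2)
  | (s, Colour.green) => if Odd s then ((s - 1) / 2, 3) else (s / 2, 1)

theorem contract_dilate {x : ℕ × Fin 4} (hx : 0 < x.1) : contract (dilate x) = x := by
  obtain ⟨_ | k, i⟩ := x
  · exact absurd hx (lt_irrefl 0)
  · fin_cases i <;> simp [dilate, primcDilation, contract, Nat.mul_add_one, Nat.odd_add_one]
    omega

theorem contract_pos {x : ℕ × Colour} (hx : 0 < x.1) (hgreen : x ≠ (1, Colour.green)) :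
    0 < (contract x).1 := by
  obtain ⟨s, _ | _⟩ := x <;> rcases Nat.even_or_odd' s with ⟨n, rfl | rfl⟩ <;>
    simp [contract, Nat.odd_iff] at hx hgreen ⊢ <;> omega

theorem dilate_contract {x : ℕ × Colour} (hx : 0 < x.1) : dilate (contract x) = x := by
  obtain ⟨s, _ | _⟩ := x <;> rcases Nat.even_or_odd' s with ⟨n, rfl | rfl⟩ <;>
    simp [contract, dilate, primcDilation, Nat.odd_iff] at hx ⊢
  omega

theorem dilate_pos {x : ℕ × Fin 4} (hx : 0 < x.1) : 0 < (dilate x).1 := by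
  obtain ⟨k, i⟩ := x
  fin_cases i <;> simp [dilate, primcDilation] at hx ⊢ <;> omega

theorem dilate_ne_green_one {x : ℕ × Fin 4} (hx : 0 < x.1) : dilate x ≠ (1, Colour.green) := by
  obtain ⟨k, i⟩ := x
  fin_cases i <;> simp [dilate, primcDilation] at hx ⊢
  omega

theorem minGap_dilate {x y : ℕ × Fin 4} (hx : 0 < x.1) (hy : 0 < y.1) :
    ((dilate y).1 ≤ (dilate x).1 ∧ (dilate y).1 + minGap (dilate x) (dilate y) ≤ (dilate x).1) ↔
      PrimcRel x y := by
  obtain ⟨_ | k, i⟩ := x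
  · exact absurd hx (lt_irrefl 0)
  obtain ⟨_ | n, j⟩ := y
  · exact absurd hy (lt_irrefl 0)
  fin_cases i <;> fin_cases j <;>
    simp [dilate, primcDilation, minGap, PrimcRel, primcMatrix, Nat.mul_add_one,
      Nat.odd_add_one] <;>
    omega

/-- The two-coloured partitions counted by `A₂`. -/
def gapPartitions : Set (Multiset (ℕ × Colour)) :=
  {p | IsColouredPartition p ∧ (1, Colour.green) ∉ p ∧ GapCondition p}

theorem image_dilate_primcLists :
    (fun l => (l.map dilate : Multiset (ℕ × Colour))) '' primcLists = gapPartitions := by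
  refine Set.Subset.antisymm ?_ ?_
  · rintro _ ⟨l, ⟨hpos, hl⟩, rfl⟩
    refine ⟨fun x hx => ?_, fun hgreen => ?_, l.map dilate, rfl, ?_⟩
    · obtain ⟨y, hy, rfl⟩ := List.mem_map.1 (Multiset.mem_coe.1 hx)
      exact dilate_pos (hpos y hy)
    · obtain ⟨y, hy, hy'⟩ := List.mem_map.1 (Multiset.mem_coe.1 hgreen)
      exact dilate_ne_green_one (hpos y hy) hy'
    · rw [List.isChain_map]
      exact hl.imp_of_mem_imp fun x y hx hy h => (minGap_dilate (hpos x hx) (hpos y hy)).2 h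
  · rintro _ ⟨hpos, hgreen, l, rfl, hl⟩
    have hmap : (l.map contract).map dilate = l := by
      rw [List.map_map]
      exact (List.map_congr_left fun x hx => dilate_contract (hpos x hx)).trans (List.map_id l)
    have hpos' : ∀ x ∈ l.map contract, 0 < x.1 := fun x hx => by
      obtain ⟨y, hy, rfl⟩ := List.mem_map.1 hx
      exact contract_pos (hpos y hy) (ne_of_mem_of_not_mem hy hgreen)
    refine ⟨l.map contract, ⟨hpos', ?_⟩, congrArg _ hmap⟩
    rw [← hmap, List.isChain_map] at hl
    exact hl.imp_of_mem_imp fun x y hx hy h => (minGap_dilate (hpos' x hx) (hpos' y hy)).1 h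

theorem primcLists_injOn_dilate :
    primcLists.InjOn fun l => (l.map dilate : Multiset (ℕ × Colour)) := by
  have hinv : ∀ l ∈ primcLists, (l.map dilate).map contract = l := fun l hl => by
    rw [List.map_map]
    exact (List.map_congr_left fun x hx => contract_dilate (hl.1 x hx)).trans (List.map_id l)
  refine fun l hl l' hl' h => primcLists_injOn_coe hl hl' ?_
  have := congrArg (Multiset.map contract) h
  simpa only [Multiset.map_coe, hinv l hl, hinv l' hl'] using this

/-- The weight of a part of size `s` in the generating function of `A₂`: the factor `q ^ s`, and `a`
for an odd red part, `c` for an even red part, `d` for an odd green part. -/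
def gapWeight {M : Type*} [CommMonoid M] (q a c d : M) : ℕ × Colour → M :=
  partWeight (fun x => Odd x.1 ∧ x.2 = Colour.red) (fun x => Even x.1 ∧ x.2 = Colour.red)
    (fun x => Odd x.1 ∧ x.2 = Colour.green) q a c d

theorem genFun_A₂ : genFun A₂ = ∑' p : gapPartitions, ((p : Multiset (ℕ × Colour)).map
    (gapWeight (var .q) (var .a) (var .c) (var .d))).prod :=
  genFun_eq_tsum _ _ _ (fun _ hp => hp.1) fun n k l m => by
    simp only [A₂, gapPartitions, Set.mem_ofPred_eq, and_assoc, and_left_comm]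

theorem primcCount_eq (n : ℕ) : primcCount n = {p ∈ gapPartitions | size p = n}.ncard := by
  have hsize : ∀ l : List (ℕ × Fin 4), size (l.map dilate : Multiset (ℕ × Colour)) =
      (l.map primcDilation).sum := fun l => by simp [size, Function.comp_def, dilate]
  have himage : {p ∈ gapPartitions | size p = n} =
      (fun l => (l.map dilate : Multiset (ℕ × Colour))) ''
        {l ∈ primcLists | (l.map primcDilation).sum = n} := by
    simp only [← image_dilate_primcLists, ← hsize]
    exact Set.image_inter_preimage _ primcLists {p | size p = n} |>.symm
  rw [himage, (primcLists_injOn_dilate.mono (Set.sep_subset _ _)).ncard_image,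
    ← (primcLists_injOn_coe.mono (Set.sep_subset _ _)).ncard_image, primcCount]
  congr 1
  ext p
  constructor
  · rintro ⟨hp, ⟨l, rfl, hl⟩, hs⟩
    exact ⟨l, ⟨⟨hp, hl⟩, by simpa using hs⟩, rfl⟩
  · rintro ⟨l, ⟨⟨hp, hl⟩, hs⟩, rfl⟩
    exact ⟨hp, ⟨l, rfl, hl⟩, by simpa using hs⟩

end Dilation

/-! ### Enumeration of Primc's partitions by their largest part -/

section PrimcWeight

/-- The weights of the parts of Primc's partitions in the generating function of `A₂`. -/
def primcWeight {M : Type*} [CommMonoid M] (q a c d : M) : ℕ × Fin 4 → M :=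
  gapWeight q a c d ∘ dilate

variable {M : Type*} [CommMonoid M] (q a c d : M) (k : ℕ)

theorem primcWeight_zero : primcWeight q a c d (k + 1, 0) = a * q * (q ^ 2) ^ k := by
  have h : 2 * (k + 1) - 1 = 2 * k + 1 := by omega
  have heven : ¬Even (2 * k + 1) := Nat.not_even_iff_odd.2 (odd_two_mul_add_one k)
  simp only [primcWeight, gapWeight, partWeight, dilate, primcDilation, Function.comp_apply,
    Matrix.cons_val, h, heven, odd_two_mul_add_one, reduceCtorEq, and_self, and_true, and_false,
    ↓reduceIte, mul_one, pow_add, pow_mul, pow_one]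
  rw [mul_comm, mul_comm ((q ^ 2) ^ k), mul_assoc]

theorem primcWeight_one : primcWeight q a c d (k, 1) = (q ^ 2) ^ k := by
  simp [primcWeight, gapWeight, partWeight, dilate, primcDilation, pow_mul]

theorem primcWeight_two : primcWeight q a c d (k, 2) = c * (q ^ 2) ^ k := by
  have h : ¬Odd (2 * k) := Nat.not_odd_iff_even.2 (even_two_mul k)
  simp [primcWeight, gapWeight, partWeight, dilate, primcDilation, h, pow_mul, mul_comm c]

theorem primcWeight_three : primcWeight q a c d (k, 3) = d * q * (q ^ 2) ^ k := by
  simp only [primcWeight, gapWeight, partWeight, dilate, primcDilation, Function.comp_apply,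
    Matrix.cons_val, odd_two_mul_add_one, reduceCtorEq, and_self, and_false, ↓reduceIte, mul_one,
    pow_add, pow_mul, pow_one]
  rw [mul_comm, mul_comm ((q ^ 2) ^ k), mul_assoc]

variable {σ R : Type} [CommRing R] {q : MvPowerSeries σ R}

theorem isLocallyFinite_primcLists (hq : q.constantCoeff = 0) (a c d : MvPowerSeries σ R) :
    IsLocallyFinite (fun l => (l.map (primcWeight q a c d)).prod) primcLists := by
  have h : IsLocallyFinite (fun p => (p.map (gapWeight q a c d)).prod) gapPartitions :=
    isLocallyFinite_prod_map_partWeight _ _ _ (fun _ hp => hp.1) hq a c d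
  rw [← image_dilate_primcLists] at h
  have hlists := h.comp_injOn primcLists_injOn_dilate (Set.mapsTo_image _ _)
  simpa only [primcWeight, Function.comp_def, Multiset.map_coe, List.map_map,
    Multiset.prod_coe] using hlists

end PrimcWeight

section HeadSum

open Filter Topology

variable {σ R : Type} [CommRing R] [TopologicalSpace R]
  {w : ℕ × Fin 4 → MvPowerSeries σ R} {H H' : Set (Option (ℕ × Fin 4))} {x : ℕ × Fin 4}

/-- The generating function, for the weight `w` on parts, of Primc's partitions whose largest part
(`none` for the empty partition) lies in `H`. -/
noncomputable def headSum (w : ℕ × Fin 4 → MvPowerSeries σ R) (H : Set (Option (ℕ × Fin 4))) :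
    MvPowerSeries σ R :=
  ∑' l : {l ∈ primcLists | l.head? ∈ H}, ((l : List (ℕ × Fin 4)).map w).prod

/-- The possible heads of the rest of one of Primc's partitions after the part `x`. -/
def successors (x : ℕ × Fin 4) : Set (Option (ℕ × Fin 4)) :=
  {o | ∀ y ∈ o, PrimcRel x y}

/-- The possible heads of Primc's partitions into parts of size at most `k`. -/
def headsLE (k : ℕ) : Set (Option (ℕ × Fin 4)) :=
  {o | ∀ y ∈ o, y.1 ≤ k}

theorem headSum_eq_one (hnone : none ∈ H) (hsome : ∀ x, some x ∈ H → x.1 = 0) :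
    headSum w H = 1 := by
  have hnil : {l ∈ primcLists | l.head? ∈ H} = {[]} := by
    ext (_ | ⟨x, l⟩)
    · simp [nil_mem_primcLists, hnone]
    · simp only [Set.mem_ofPred_eq, cons_mem_primcLists, List.head?_cons, Set.mem_singleton_iff,
        reduceCtorEq, iff_false, not_and]
      exact fun hx hxH => hx.1.ne' (hsome x hxH)
  rw [headSum, hnil, tsum_singleton [] fun l => (l.map w).prod, List.map_nil, List.prod_nil]

theorem headSum_singleton_zero (i : Fin 4) : headSum w {some (0, i)} = 0 := by
  have hempty : {l ∈ primcLists | l.head? ∈ ({some (0, i)} : Set (Option (ℕ × Fin 4)))} = ∅ := by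
    rw [Set.eq_empty_iff_forall_notMem]
    rintro (_ | ⟨x, l⟩) ⟨hl, hhead⟩
    · exact absurd hhead (by simp)
    · obtain rfl : x = (0, i) := Option.some.inj hhead
      exact lt_irrefl 0 (cons_mem_primcLists.1 hl).1
  rw [headSum, hempty, tsum_empty]

variable [T2Space R]

theorem tendsto_headSum (hw : IsLocallyFinite (fun l => (l.map w).prod) primcLists)
    {H : ℕ → Set (Option (ℕ × Fin 4))} (hH : ∀ o, ∀ᶠ k in atTop, o ∈ H k) :
    Tendsto (fun k => headSum w (H k)) atTop
      (𝓝 (∑' l : primcLists, ((l : List (ℕ × Fin 4)).map w).prod)) :=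
  hw.tendsto_tsum (fun _ => Set.sep_subset _ _) fun l hl => (hH l.head?).mono fun _ h => ⟨hl, h⟩

variable [IsTopologicalRing R]

theorem headSum_union (hw : IsLocallyFinite (fun l => (l.map w).prod) primcLists)
    (hd : Disjoint H H') : headSum w (H ∪ H') = headSum w H + headSum w H' := by
  have hunion : {l ∈ primcLists | l.head? ∈ H ∪ H'} =
      {l ∈ primcLists | l.head? ∈ H} ∪ {l ∈ primcLists | l.head? ∈ H'} :=
    Set.inter_union_distrib_left primcLists _ _
  rw [headSum, hunion]
  refine (hw.mono (Set.union_subset (Set.sep_subset _ _) (Set.sep_subset _ _))).tsum_union ?_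
  exact Set.disjoint_left.2 fun l hl hl' => hd.notMem_of_mem_left hl.2 hl'.2

theorem headSum_singleton (hw : IsLocallyFinite (fun l => (l.map w).prod) primcLists)
    (hx : 0 < x.1) : headSum w {some x} = w x * headSum w (successors x) := by
  have himage : {l ∈ primcLists | l.head? ∈ ({some x} : Set (Option (ℕ × Fin 4)))} =
      List.cons x '' {l ∈ primcLists | l.head? ∈ successors x} := by
    ext (_ | ⟨y, l⟩)
    · simp
    · simp only [Set.mem_ofPred_eq, cons_mem_primcLists, List.head?_cons, Set.mem_singleton_iff,
        Option.some.injEq, Set.mem_image, List.cons.injEq, successors]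
      constructor
      · rintro ⟨⟨-, hsucc, hl⟩, rfl⟩
        exact ⟨l, ⟨hl, hsucc⟩, rfl, rfl⟩
      · rintro ⟨l, ⟨hl, hsucc⟩, rfl, rfl⟩
        exact ⟨⟨hx, hsucc, hl⟩, rfl⟩
  rw [headSum, himage, tsum_image (fun l => (l.map w).prod) List.cons_injective.injOn, headSum,
    ← (hw.mono (Set.sep_subset _ _)).summable.tsum_mul_left]
  simp only [List.map_cons, List.prod_cons]

end HeadSum

section Successors

open Filter

theorem none_mem_successors (x : ℕ × Fin 4) : none ∈ successors x := by simp [successors]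

theorem some_mem_successors {x y : ℕ × Fin 4} : some y ∈ successors x ↔ PrimcRel x y := by
  simp only [successors, Set.mem_ofPred_eq, Option.mem_some_iff, forall_eq']

theorem none_mem_headsLE (k : ℕ) : none ∈ headsLE k := by simp [headsLE]

theorem some_mem_headsLE {k : ℕ} {y : ℕ × Fin 4} : some y ∈ headsLE k ↔ y.1 ≤ k := by
  simp only [headsLE, Set.mem_ofPred_eq, Option.mem_some_iff, forall_eq']

theorem successors_succ_zero (k : ℕ) : successors (k + 1, 0) = successors (k, 1) := by
  ext (_ | ⟨n, i⟩)
  · simp [none_mem_successors]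
  · fin_cases i <;> simp [some_mem_successors, PrimcRel, primcMatrix] <;> omega

theorem successors_three (k : ℕ) : successors (k, 3) = successors (k, 2) := by
  ext (_ | ⟨n, i⟩)
  · simp [none_mem_successors]
  · fin_cases i <;> simp [some_mem_successors, PrimcRel, primcMatrix]
    omega

theorem successors_succ_one (k : ℕ) :
    successors (k + 1, 1) = headsLE k ∪ {some (k + 1, 1)} := by
  ext (_ | ⟨n, i⟩)
  · simp [none_mem_successors, none_mem_headsLE]
  · fin_cases i <;> simp [some_mem_successors, some_mem_headsLE, PrimcRel, primcMatrix] <;> omega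

theorem headsLE_succ (k : ℕ) : headsLE (k + 1) =
    successors (k + 1, 1) ∪ {some (k + 1, 0)} ∪ {some (k + 1, 2)} ∪ {some (k + 1, 3)} := by
  ext (_ | ⟨n, i⟩)
  · simp [none_mem_successors, none_mem_headsLE]
  · fin_cases i <;> simp [some_mem_successors, some_mem_headsLE, PrimcRel, primcMatrix] <;> omega

theorem successors_succ_two (k : ℕ) : successors (k + 1, 2) ∪ {some (k, 3)} =
    headsLE k ∪ {some (k + 1, 0)} ∪ {some (k + 1, 2)} := by
  ext (_ | ⟨n, i⟩)
  · simp [none_mem_successors, none_mem_headsLE]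
  · fin_cases i <;> simp [some_mem_successors, some_mem_headsLE, PrimcRel, primcMatrix] <;> omega

theorem eventually_mem_successors_one (o : Option (ℕ × Fin 4)) :
    ∀ᶠ k in atTop, o ∈ successors (k, 1) := by
  rcases o with _ | y
  · exact Eventually.of_forall fun k => none_mem_successors (k, 1)
  · filter_upwards [eventually_gt_atTop y.1] with k hk
    obtain ⟨k, rfl⟩ := Nat.exists_eq_succ_of_ne_zero (Nat.ne_zero_of_lt hk)
    rw [successors_succ_one]
    exact Or.inl (some_mem_headsLE.2 (Nat.le_of_lt_succ hk))

end Successors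

section PrimcRecurrence

variable {σ R : Type} [CommRing R] [TopologicalSpace R]

/-- The generating function of Primc's partitions that may follow the part `k_c`, but `0` for
`k = 0`. -/
noncomputable def sumAfterC (w : ℕ × Fin 4 → MvPowerSeries σ R) : ℕ → MvPowerSeries σ R
  | 0 => 0
  | k + 1 => headSum w (successors (k + 1, 2))

variable [IsTopologicalRing R] [T2Space R] {w : ℕ × Fin 4 → MvPowerSeries σ R}

theorem headSum_singleton_three (hw : IsLocallyFinite (fun l => (l.map w).prod) primcLists)
    (k : ℕ) : headSum w {some (k, 3)} = w (k, 3) * sumAfterC w k := by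
  cases k with
  | zero => rw [headSum_singleton_zero, sumAfterC, mul_zero]
  | succ k => rw [headSum_singleton hw k.succ_pos, successors_three, sumAfterC]

theorem headSum_successors_succ_one
    (hw : IsLocallyFinite (fun l => (l.map w).prod) primcLists) (k : ℕ) :
    headSum w (successors (k + 1, 1)) =
      headSum w (headsLE k) + w (k + 1, 1) * headSum w (successors (k + 1, 1)) := by
  rw [← headSum_singleton hw k.succ_pos, ← headSum_union hw, ← successors_succ_one]
  simp [some_mem_headsLE]

theorem headSum_headsLE_succ (hw : IsLocallyFinite (fun l => (l.map w).prod) primcLists) (k : ℕ) :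
    headSum w (headsLE (k + 1)) = headSum w (successors (k + 1, 1)) +
      w (k + 1, 0) * headSum w (successors (k, 1)) + w (k + 1, 2) * sumAfterC w (k + 1) +
        w (k + 1, 3) * sumAfterC w (k + 1) := by
  rw [← headSum_singleton_three hw, sumAfterC, headsLE_succ, headSum_union hw, headSum_union hw,
    headSum_union hw, headSum_singleton hw k.succ_pos, headSum_singleton hw k.succ_pos,
    successors_succ_zero] <;>
  simp [some_mem_successors, PrimcRel, primcMatrix]

theorem sumAfterC_succ (hw : IsLocallyFinite (fun l => (l.map w).prod) primcLists) (k : ℕ) :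
    sumAfterC w (k + 1) + w (k, 3) * sumAfterC w k = headSum w (headsLE k) +
      w (k + 1, 0) * headSum w (successors (k, 1)) + w (k + 1, 2) * sumAfterC w (k + 1) := by
  rw [← headSum_singleton_three hw, sumAfterC, ← headSum_union hw, successors_succ_two,
    headSum_union hw, headSum_union hw, headSum_singleton hw k.succ_pos,
    headSum_singleton hw k.succ_pos, successors_succ_zero] <;>
  simp [some_mem_headsLE, some_mem_successors, PrimcRel, primcMatrix]

variable {q : MvPowerSeries σ R}

theorem largestPartRecurrence_primcWeight (hq : q.constantCoeff = 0) (a c d : MvPowerSeries σ R) :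
    LargestPartRecurrence (q ^ 2) (a * q) c (d * q)
      (fun k => headSum (primcWeight q a c d) (successors (k, 1)))
      (sumAfterC (primcWeight q a c d)) := by
  have hw := isLocallyFinite_primcLists hq a c d
  have hone := headSum_successors_succ_one hw
  have hle := headSum_headsLE_succ hw
  have htwo := sumAfterC_succ hw
  simp only [primcWeight_zero, primcWeight_one, primcWeight_two, primcWeight_three] at hone hle htwo
  have hle_zero : headSum (primcWeight q a c d) (headsLE 0) = 1 :=
    headSum_eq_one (none_mem_headsLE 0) fun x hx => Nat.le_zero.1 (some_mem_headsLE.1 hx)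
  refine ⟨headSum_eq_one (none_mem_successors (0, 1)) fun x hx => ?_, ?_, rfl, fun k => ?_,
    fun k => ?_⟩
  · have := (some_mem_successors.1 hx).2
    omega
  · linear_combination hone 0 + hle_zero
  · linear_combination hle k + hone (k + 1)
  · linear_combination htwo k - hone k

end PrimcRecurrence

section GapPartitions

variable {σ R : Type} [CommRing R] [TopologicalSpace R] [IsTopologicalRing R] [T2Space R]
  [IsLinearTopology R R] {q : MvPowerSeries σ R}

theorem tsum_gapPartitions_mul (hq : q.constantCoeff = 0) (a c d : MvPowerSeries σ R) :
    (∑' p : gapPartitions, ((p : Multiset (ℕ × Colour)).map (gapWeight q a c d)).prod) *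
      (qPochhammer (q ^ 2) (q ^ 2) * qPochhammer (c * q ^ 2) (q ^ 4)) =
    qPochhammer (-(a * q)) (q ^ 4) * qPochhammer (-(d * q ^ 3)) (q ^ 4) := by
  have hlists : ∑' p : gapPartitions, ((p : Multiset (ℕ × Colour)).map (gapWeight q a c d)).prod =
      ∑' l : primcLists, ((l : List (ℕ × Fin 4)).map (primcWeight q a c d)).prod := by
    rw [← image_dilate_primcLists,
      tsum_image (fun p : Multiset (ℕ × Colour) => (p.map (gapWeight q a c d)).prod)
        primcLists_injOn_dilate]
    simp only [Multiset.map_coe, List.map_map, Multiset.prod_coe, primcWeight]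
  have hlim := (largestPartRecurrence_primcWeight hq a c d).limit_mul_qPochhammer
    (by simp [hq]) (tendsto_headSum (isLocallyFinite_primcLists hq a c d)
      eventually_mem_successors_one)
  rw [← pow_mul, mul_assoc d, ← pow_succ'] at hlim
  rwa [hlists]

end GapPartitions

/-! ### The identities -/

section ProductSide

variable {σ R : Type} [CommRing R] [TopologicalSpace R] {q : MvPowerSeries σ R}

theorem qPochhammerConverges_pow (x : MvPowerSeries σ R) (hq : q.constantCoeff = 0) {n : ℕ}
    (hn : n ≠ 0) : QPochhammerConverges x (q ^ n) :=
  qPochhammerConverges x (by simp [hq, hn])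

variable [T2Space R]

theorem isUnit_denominator (hq : q.constantCoeff = 0) (c : MvPowerSeries σ R) :
    IsUnit (qPochhammer (q ^ 2) (q ^ 2) * qPochhammer (c * q ^ 2) (q ^ 4)) :=
  (isUnit_qPochhammer (by simp [hq]) (by simp [hq])).mul
    (isUnit_qPochhammer (by simp [hq]) (by simp [hq]))

theorem isUnit_primc_denominator (hq : q.constantCoeff = 0) :
    IsUnit (qPochhammer (q ^ 2) (q ^ 2) * qPochhammer (q ^ 2) (q ^ 4)) := by
  simpa only [one_mul] using isUnit_denominator hq 1

variable [IsTopologicalRing R]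

theorem qPochhammer_primc (hq : q.constantCoeff = 0) :
    qPochhammer (-q) (q ^ 4) * qPochhammer (-(q ^ 3)) (q ^ 4) * qPochhammer q q =
      qPochhammer (q ^ 2) (q ^ 2) * qPochhammer (q ^ 2) (q ^ 4) := by
  have conv₂ (x : MvPowerSeries σ R) : QPochhammerConverges x (q ^ 2) :=
    qPochhammerConverges_pow x hq two_ne_zero
  have conv₄ (x : MvPowerSeries σ R) : QPochhammerConverges x ((q ^ 2) ^ 2) :=
    qPochhammerConverges x (by simp [hq])
  have hnum : qPochhammer (-q) (q ^ 4) * qPochhammer (-(q ^ 3)) (q ^ 4) =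
      qPochhammer (-q) (q ^ 2) := by
    simpa only [← pow_mul, neg_mul, ← pow_succ'] using
      qPochhammer_mul_qPochhammer_mul (conv₄ (-q)) (conv₄ _)
  have hsplit : qPochhammer q (q ^ 2) * qPochhammer (q ^ 2) (q ^ 2) = qPochhammer q q := by
    simpa only [← sq] using qPochhammer_mul_qPochhammer_mul (conv₂ q) (conv₂ _)
  have hsign : qPochhammer q (q ^ 2) * qPochhammer (-q) (q ^ 2) = qPochhammer (q ^ 2) (q ^ 4) := by
    simpa only [← pow_mul] using qPochhammer_mul_qPochhammer_neg (conv₂ q) (conv₂ _)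
  rw [hnum, ← hsplit, ← hsign]
  ring

theorem qPochhammer_primc_div (hq : q.constantCoeff = 0) :
    qPochhammer (-q) (q ^ 4) * qPochhammer (-(q ^ 3)) (q ^ 4) *
        Ring.inverse (qPochhammer (q ^ 2) (q ^ 2) * qPochhammer (q ^ 2) (q ^ 4)) =
      Ring.inverse (qPochhammer q q) := by
  refine (isUnit_qPochhammer hq hq).mul_right_cancel ?_
  rw [mul_right_comm, qPochhammer_primc hq, Ring.mul_inverse_cancel _ (isUnit_primc_denominator hq),
    Ring.inverse_mul_cancel _ (isUnit_qPochhammer hq hq)]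

end ProductSide

section Equinumerosity

theorem constantCoeff_var (v : Var) : (var v).constantCoeff = 0 :=
  MvPowerSeries.constantCoeff_X v

theorem genFun_injective : Function.Injective genFun := fun F G h => by
  funext n k l m
  have := congrFun h (Finsupp.single Var.q n + Finsupp.single Var.a k +
    Finsupp.single Var.c l + Finsupp.single Var.d m)
  simpa [genFun] using this

theorem genFun_A₂_mul_denominator :
    genFun A₂ * (qPochhammer (var .q ^ 2) (var .q ^ 2) *
        qPochhammer (var .c * var .q ^ 2) (var .q ^ 4)) =
      qPochhammer (-(var .a * var .q)) (var .q ^ 4) *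
        qPochhammer (-(var .d * var .q ^ 3)) (var .q ^ 4) := by
  rw [genFun_A₂, tsum_gapPartitions_mul (constantCoeff_var .q)]

theorem A₂_eq_B₂ : A₂ = B₂ :=
  genFun_injective <| (isUnit_denominator (constantCoeff_var .q) (var .c)).mul_right_cancel <| by
    rw [genFun_A₂_mul_denominator, genFun_B₂, tsum_distinctOddPartitions_mul (constantCoeff_var .q)]

end Equinumerosity

section PrimcIdentity

theorem hasSum_ncard_fibre {α β : Type*} {S : Set α} (hS : S.Finite) (f : α → β) :
    HasSum (fun b => {x ∈ S | f x = b}.ncard) S.ncard := by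
  classical
  obtain ⟨s, rfl⟩ := hS.exists_finset_coe
  have hfibre : ∀ b, {x ∈ (s : Set α) | f x = b}.ncard = (s.filter fun x => f x = b).card :=
    fun b => by rw [← Set.ncard_coe_finset, Finset.coe_filter]; rfl
  simp only [hfibre]
  rw [Set.ncard_coe_finset, Finset.card_eq_sum_card_image f s]
  refine hasSum_sum_of_ne_finset_zero fun b hb => ?_
  rw [Finset.card_eq_zero, Finset.filter_eq_empty_iff]
  rintro x hx rfl
  exact hb (Finset.mem_image_of_mem f hx)

theorem hasSum_A₂ (n : ℕ) :
    HasSum (fun v : ℕ × ℕ × ℕ => A₂ n v.1 v.2.1 v.2.2) (primcCount n) := by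
  have hfinite : {p ∈ gapPartitions | size p = n}.Finite :=
    (finite_colouredPartitions n).subset fun _ hp => ⟨hp.1.1, hp.2⟩
  rw [primcCount_eq]
  refine (hasSum_ncard_fibre hfinite fun p =>
    (p.countP fun x => Odd x.1 ∧ x.2 = Colour.red, p.countP fun x => Even x.1 ∧ x.2 = Colour.red,
      p.countP fun x => Odd x.1 ∧ x.2 = Colour.green)).congr_fun fun v => ?_
  simp only [A₂, gapPartitions, Set.mem_ofPred_eq, Prod.ext_iff, and_assoc, and_left_comm]

theorem mk_primcCount_mul_denominator :
    letI q : PowerSeries ℤ := PowerSeries.X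
    PowerSeries.mk (fun n => (primcCount n : ℤ)) *
        (qPochhammer (q ^ 2) (q ^ 2) * qPochhammer (q ^ 2) (q ^ 4)) =
      qPochhammer (-q) (q ^ 4) * qPochhammer (-(q ^ 3)) (q ^ 4) := by
  have h := tsum_gapPartitions_mul (σ := Unit) (R := ℤ) (q := PowerSeries.X)
    (MvPowerSeries.constantCoeff_X ()) 1 1 1
  simp only [gapWeight, prod_map_partWeight, one_pow, mul_one, one_mul] at h
  simp only [primcCount_eq]
  rw [powerSeries_mk_ncard fun _ hp => hp.1]
  exact h

end PrimcIdentity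

end PrimcRefined

theorem mainTheorem2 :
    -- the four-variable generating function of `A₂`, in `ℤ⟦q, a, c, d⟧`
    (let q := var Var.q
     let a := var Var.a
     let c := var Var.c
     let d := var Var.d
     QPochhammerConverges (-(a * q)) (q ^ 4) ∧
     QPochhammerConverges (-(d * q ^ 3)) (q ^ 4) ∧
     QPochhammerConverges (q ^ 2) (q ^ 2) ∧
     QPochhammerConverges (c * q ^ 2) (q ^ 4) ∧
     IsUnit (qPochhammer (q ^ 2) (q ^ 2) * qPochhammer (c * q ^ 2) (q ^ 4)) ∧
     genFun A₂ =
       qPochhammer (-(a * q)) (q ^ 4) * qPochhammer (-(d * q ^ 3)) (q ^ 4) *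
         Ring.inverse (qPochhammer (q ^ 2) (q ^ 2) * qPochhammer (c * q ^ 2) (q ^ 4))) ∧
    -- equinumerosity
    (∀ n k l m : ℕ, A₂ n k l m = B₂ n k l m) ∧
    -- setting `a = c = d = 1`: Primc's identity, in `ℤ⟦q⟧`
    (∀ n : ℕ, HasSum (fun v : ℕ × ℕ × ℕ => A₂ n v.1 v.2.1 v.2.2) (primcCount n)) ∧
    (let q : PowerSeries ℤ := PowerSeries.X
     QPochhammerConverges (-q) (q ^ 4) ∧
     QPochhammerConverges (-(q ^ 3)) (q ^ 4) ∧
     QPochhammerConverges (q ^ 2) (q ^ 2) ∧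
     QPochhammerConverges (q ^ 2) (q ^ 4) ∧
     QPochhammerConverges q q ∧
     IsUnit (qPochhammer (q ^ 2) (q ^ 2) * qPochhammer (q ^ 2) (q ^ 4)) ∧
     IsUnit (qPochhammer q q) ∧
     qPochhammer (-q) (q ^ 4) * qPochhammer (-(q ^ 3)) (q ^ 4) *
         Ring.inverse (qPochhammer (q ^ 2) (q ^ 2) * qPochhammer (q ^ 2) (q ^ 4)) =
       Ring.inverse (qPochhammer q q) ∧
     PowerSeries.mk (fun n => (primcCount n : ℤ)) = Ring.inverse (qPochhammer q q)) := by
  have hq := constantCoeff_var .q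
  have hden := isUnit_denominator hq (var .c)
  have hX : MvPowerSeries.constantCoeff (σ := Unit) (R := ℤ) PowerSeries.X = 0 :=
    MvPowerSeries.constantCoeff_X ()
  have hdenX := isUnit_primc_denominator hX
  have hdivX := qPochhammer_primc_div hX
  have hmkX := (Ring.eq_mul_inverse_iff_mul_eq _ _ _ hdenX).2 mk_primcCount_mul_denominator
  exact ⟨⟨qPochhammerConverges_pow _ hq four_ne_zero, qPochhammerConverges_pow _ hq four_ne_zero,
      qPochhammerConverges_pow _ hq two_ne_zero, qPochhammerConverges_pow _ hq four_ne_zero, hden,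
      (Ring.eq_mul_inverse_iff_mul_eq _ _ _ hden).2 genFun_A₂_mul_denominator⟩,
    fun n k l m => by rw [A₂_eq_B₂], hasSum_A₂,
    qPochhammerConverges_pow _ hX four_ne_zero, qPochhammerConverges_pow _ hX four_ne_zero,
    qPochhammerConverges_pow _ hX two_ne_zero, qPochhammerConverges_pow _ hX four_ne_zero,
    qPochhammerConverges _ hX, hdenX, isUnit_qPochhammer hX hX, hdivX, hmkX.trans hdivX⟩
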